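/- Consider $n\ge 1$ agents and $m\ge 1$ indivisible goods. Every agent $i$ has a weight $w_i>0$ and an additive valuation $v_i(S)=\sum_{e\in S}v_i(e)$ that is bivalued: there is one real number $k>1$ such that $v_i(e)\in\{1,k\}$ for all agents $i$ and all goods $e$. An allocation is a partition $X=(X_1,\dots,X_n)$ of the set of goods into $n$ (possibly empty) bundles. It is WEFX (weighted envy-free up to any good) if $\frac{v_i(X_i)}{w_i}\ge\frac{v_i(X_j\setminus\{e\})}{w_j}$ for all agents $i,j$ and every $e\in X_j$. It is fPO (fractionally Pareto optimal) if there is no fractional allocation $y$ (that is, $y_{i,e}\ge 0$ for all $i,e$ and $\sum_i y_{i,e}=1$ for every good $e$) with $\sum_e y_{i,e}v_i(e)\ge v_i(X_i)$ for all $i$ and strict inequality for some $i$. There is a polynomial-time algorithm that, for every such instance (given by $n$, $m$, $k$, the weights and the values), computes an allocation that is both WEFX and fPO. More precisely, there are a single program for a random access machine with exact real arithmetic (unit cost for reading and writing a cell, for addition, subtraction and comparison of natural or of real numbers, and for multiplication of a real number by an input number) and a constant $C$ such that on every such instance the program halts with a WEFX and fPO allocation after at most $C\cdot\min\{k,m\}\,n^2m^2$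 steps. -/

import Mathlib

/-! ### Bivalued instances, allocations, fairness and efficiency -/

/-- A bivalued instance with `n` agents and `m` goods: positive agent weights, and for every agent
and every good a value in `{1, k}`, where `k > 1`. -/
structure BivaluedInstance (n m : ℕ) where
  k : ℝ
  one_lt_k : 1 < k
  w : Fin n → ℝ
  w_pos : ∀ i, 0 < w i
  v : Fin n → Fin m → ℝ
  v_mem : ∀ i e, v i e = 1 ∨ v i e = k

/-- The bundle `X_i` of agent `i`. An (integral) allocation is a partition of the goods into `n`
(possibly empty) bundles; it is given by the map `X` that sends every good to its owner. -/
def bundle {n m : ℕ} (X : Fin m → Fin n) (i : Fin n) : Finset (Fin m) :=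
  Finset.univ.filter fun e => X e = i

/-- A fractional allocation: `y i e` is the share of good `e` that agent `i` gets, and every good
is completely distributed. -/
def IsFractionalAllocation {n m : ℕ} (y : Fin n → Fin m → ℝ) : Prop :=
  (∀ i e, 0 ≤ y i e) ∧ ∀ e, ∑ i, y i e = 1

namespace BivaluedInstance

variable {n m : ℕ}

/-- The additive value `v_i(S)` of a set `S` of goods. -/
noncomputable def value (I : BivaluedInstance n m) (i : Fin n) (S : Finset (Fin m)) : ℝ :=
  ∑ e ∈ S, I.v i e

/-- The value for agent `i` of her share in a fractional allocation. -/
noncomputable def fracValue (I : BivaluedInstance n m) (i : Fin n) (y : Fin n → Fin m → ℝ) : ℝ :=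
  ∑ e, y i e * I.v i e

/-- Weighted envy-freeness up to any good. -/
def WEFX (I : BivaluedInstance n m) (X : Fin m → Fin n) : Prop :=
  ∀ i j, ∀ e ∈ bundle X j,
    I.value i (bundle X i) / I.w i ≥ I.value i ((bundle X j).erase e) / I.w j

/-- The fractional allocation `y` dominates the allocation `X`. -/
def FracDominates (I : BivaluedInstance n m) (y : Fin n → Fin m → ℝ) (X : Fin m → Fin n) : Prop :=
  (∀ i, I.value i (bundle X i) ≤ I.fracValue i y) ∧
    ∃ j, I.value j (bundle X j) < I.fracValue j y

/-- Fractional Pareto optimality. -/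
def FPO (I : BivaluedInstance n m) (X : Fin m → Fin n) : Prop :=
  ¬ ∃ y, IsFractionalAllocation y ∧ I.FracDominates y X

/-- The list of numbers that describes an instance with `n` agents and `m` goods to a machine:
`k`, then the `n` weights, then the `n × m` value matrix, row by row. -/
noncomputable def encode (I : BivaluedInstance n m) : List ℝ :=
  I.k :: (List.ofFn I.w ++ List.ofFn fun x : Fin (n * m) => I.v x.divNat x.modNat)

end BivaluedInstance

/-! ### A random access machine with exact real arithmetic

Programs are structured (assignments, conditionals, loops). They work on natural numbers (counters,
addresses) and on real numbers, each kept in variables and in arrays that can be addressed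
indirectly; the names of variables and arrays are fixed by the program. The input is a read-only
list of real numbers. All elementary operations have unit cost: addition, subtraction and comparison
of naturals and of reals, multiplication of a real by an input number, reading and writing of one
cell. There is no rounding, no conversion between reals and naturals, no multiplication of naturals
and no multiplication of two computed reals, so that numbers cannot grow by repeated squaring:
after `t` steps on rational input all numbers have a bit length polynomial in `t` and in the bit
length of the input. -/

namespace RealRAM

/-- The memory, without the read-only input. -/
structure Store where
  natVar : ℕ → ℕ
  realVar : ℕ → ℝ
  natArr : ℕ → ℕ → ℕ
  realArr : ℕ → ℕ → ℝ

/-- Expressions with values in the natural numbers; `get a e` is the cell `e` of array `a`. -/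
inductive NExp where
  | const (c : ℕ)
  | var (x : ℕ)
  | get (a : ℕ) (e : NExp)
  | add (e f : NExp)
  | sub (e f : NExp)

/-- Expressions with values in the real numbers; `input e` is the input number at position `e`, and
`mulInput r e` is the product of `r` and that number. -/
inductive RExp where
  | const (c : ℕ)
  | var (x : ℕ)
  | get (a : ℕ) (e : NExp)
  | input (e : NExp)
  | add (r q : RExp)
  | sub (r q : RExp)
  | mulInput (r : RExp) (e : NExp)

/-- Tests. -/
inductive BExp where
  | natLt (e f : NExp)
  | realLt (r q : RExp)
  | not (b : BExp)
  | and (b c : BExp)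

/-- Programs. -/
inductive Prog where
  | skip
  | setNat (x : ℕ) (e : NExp)
  | setReal (x : ℕ) (r : RExp)
  | putNat (a : ℕ) (i : NExp) (e : NExp)
  | putReal (a : ℕ) (i : NExp) (r : RExp)
  | seq (p q : Prog)
  | ite (b : BExp) (p q : Prog)
  | loop (b : BExp) (p : Prog)

/-- Value of a natural-number expression; subtraction is truncated at zero. -/
def NExp.eval (s : Store) : NExp → ℕ
  | const c => c
  | var x => s.natVar x
  | get a e => s.natArr a (e.eval s)
  | add e f => e.eval s + f.eval s
  | sub e f => e.eval s - f.eval s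

/-- Number of elementary operations in the evaluation of an expression. -/
def NExp.cost : NExp → ℕ
  | const _ => 1
  | var _ => 1
  | get _ e => e.cost + 1
  | add e f => e.cost + f.cost + 1
  | sub e f => e.cost + f.cost + 1

/-- Value of a real expression; input positions beyond the end of the input read as zero. -/
noncomputable def RExp.eval (inp : List ℝ) (s : Store) : RExp → ℝ
  | const c => (c : ℝ)
  | var x => s.realVar x
  | get a e => s.realArr a (e.eval s)
  | input e => inp.getD (e.eval s) 0
  | add r q => r.eval inp s + q.eval inp s
  | sub r q => r.eval inp s - q.eval inp s
  | mulInput r e => r.eval inp s * inp.getD (e.eval s) 0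

/-- Number of elementary operations in the evaluation of an expression. -/
def RExp.cost : RExp → ℕ
  | const _ => 1
  | var _ => 1
  | get _ e => e.cost + 1
  | input e => e.cost + 1
  | add r q => r.cost + q.cost + 1
  | sub r q => r.cost + q.cost + 1
  | mulInput r e => r.cost + e.cost + 1

/-- Truth of a test. -/
def BExp.Holds (inp : List ℝ) (s : Store) : BExp → Prop
  | natLt e f => e.eval s < f.eval s
  | realLt r q => r.eval inp s < q.eval inp s
  | not b => ¬ b.Holds inp s
  | and b c => b.Holds inp s ∧ c.Holds inp s

/-- Number of elementary operations in the evaluation of a test. -/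
def BExp.cost : BExp → ℕ
  | natLt e f => e.cost + f.cost + 1
  | realLt r q => r.cost + q.cost + 1
  | not b => b.cost + 1
  | and b c => b.cost + c.cost + 1

/-- `Run inp p s t s'`: on input `inp`, the program `p`, started with memory `s`, halts after
exactly `t` steps with memory `s'`. -/
inductive Run (inp : List ℝ) : Prog → Store → ℕ → Store → Prop where
  | skip (s : Store) : Run inp .skip s 1 s
  | setNat (x : ℕ) (e : NExp) (s : Store) :
      Run inp (.setNat x e) s (e.cost + 1)
        { s with natVar := Function.update s.natVar x (e.eval s) }
  | setReal (x : ℕ) (r : RExp) (s : Store) :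
      Run inp (.setReal x r) s (r.cost + 1)
        { s with realVar := Function.update s.realVar x (r.eval inp s) }
  | putNat (a : ℕ) (i e : NExp) (s : Store) :
      Run inp (.putNat a i e) s (i.cost + e.cost + 1)
        { s with natArr :=
            Function.update s.natArr a (Function.update (s.natArr a) (i.eval s) (e.eval s)) }
  | putReal (a : ℕ) (i : NExp) (r : RExp) (s : Store) :
      Run inp (.putReal a i r) s (i.cost + r.cost + 1)
        { s with realArr :=
            Function.update s.realArr a (Function.update (s.realArr a) (i.eval s) (r.eval inp s)) }
  | seq {p q : Prog} {s s' s'' : Store} {t t' : ℕ} :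
      Run inp p s t s' → Run inp q s' t' s'' → Run inp (.seq p q) s (t + t') s''
  | iteTrue {b : BExp} {p q : Prog} {s s' : Store} {t : ℕ} :
      b.Holds inp s → Run inp p s t s' → Run inp (.ite b p q) s (b.cost + 1 + t) s'
  | iteFalse {b : BExp} {p q : Prog} {s s' : Store} {t : ℕ} :
      ¬ b.Holds inp s → Run inp q s t s' → Run inp (.ite b p q) s (b.cost + 1 + t) s'
  | loopTrue {b : BExp} {p : Prog} {s s' s'' : Store} {t t' : ℕ} :
      b.Holds inp s → Run inp p s t s' → Run inp (.loop b p) s' t' s'' →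
        Run inp (.loop b p) s (b.cost + 1 + t + t') s''
  | loopFalse {b : BExp} {p : Prog} {s : Store} :
      ¬ b.Holds inp s → Run inp (.loop b p) s (b.cost + 1) s

/-- The memory at the start: the sizes `n` and `m` are in the first two natural-number variables,
everything else is zero. -/
def start (n m : ℕ) : Store where
  natVar := fun x => if x = 0 then n else if x = 1 then m else 0
  realVar := fun _ => 0
  natArr := fun _ _ => 0
  realArr := fun _ _ => 0

/-- The final memory `s` holds the allocation `X`: cell `e` of the natural-number array `0` is the
owner of good `e`. -/
def Outputs {n m : ℕ} (s : Store) (X : Fin m → Fin n) : Prop :=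
  ∀ e : Fin m, s.natArr 0 (e : ℕ) = (X e : ℕ)

end RealRAM

/-! ### Bivalued allocations as maps on natural numbers

Agents are the numbers below `n`, goods the numbers below `m`, `X e` is the owner of good `e`, and
`L i e` says that agent `i` has value `k` for good `e`. -/

/-! Say that an agent likes a good if she values it at `k`, and call the number of liked goods in
her own bundle, divided by her weight, her liked load. By the usual price argument (`fpo_of_prices`)
an allocation is fPO as soon as positive multipliers `α i` exist such that the owner of each good
`e` maximises `α i * v i e`. Multipliers `1` and `1/k` suffice here; `U` is the set of agents with
multiplier `1/k`.

Goods that somebody likes are inserted one at a time and always end with agents who like them. A new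
good is absorbed along an alternating path that starts at the agent of least liked load among all
agents from whom the good can be reached. This keeps the balance property: if `i` reaches `j` in the
graph of wanted goods, the liked load of `j` up to one good is at most that of `i`
(`BalancedAlong.augment`). Goods liked by nobody then go one by one to a poorest agent, so that
their owners, up to one such good, are never richer than anyone else (`FairPartial.give`).

The only envy left is that of an agent towards a bundle whose owner likes all of it while she likes
none of it. While the weighted value of the poorest agent `t` is below the largest liked load up to
one good, attained by `u`, some good of `u` moves to `t`, who does not like it. The prices stay
consistent because all agents who reach `u` enter `U`: their liked loads are so high that none of
them holds a good she does not like, and `t` is not among them (`PricedInvariant.enlarge`,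
`PricedInvariant.move`). Every move increases the number of goods held by agents who do not like
them, so `m` rounds suffice (`unlikedTotal_move`). The final state is WEFX by
`wefx_of_pricedInvariant`.

The dominant cost is the path search: `n` scans over all `m * n` pairs for each of the `m` goods.
The total is of order `n^2 * m^2`, and the factor `min k m ≥ 1` is not needed. -/

open Classical in
/-- The number of goods in the bundle of `j` that `j` likes. -/
noncomputable def likedCount (m : ℕ) (L : ℕ → ℕ → Prop) (X : ℕ → ℕ) (j : ℕ) : ℝ :=
  ∑ e ∈ Finset.range m, if X e = j ∧ L j e then 1 else 0

open Classical in
/-- The number of goods in the bundle of `j` that `j` does not like. -/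
noncomputable def unlikedCount (m : ℕ) (L : ℕ → ℕ → Prop) (X : ℕ → ℕ) (j : ℕ) : ℝ :=
  ∑ e ∈ Finset.range m, if X e = j ∧ ¬ L j e then 1 else 0

/-- The value of `j` for her own bundle. -/
noncomputable def ownValue (m : ℕ) (L : ℕ → ℕ → Prop) (k : ℝ) (X : ℕ → ℕ) (j : ℕ) : ℝ :=
  k * likedCount m L X j + unlikedCount m L X j

/-- Agent `i` likes a good in the bundle of `j`. -/
def Wants (n m : ℕ) (L : ℕ → ℕ → Prop) (X : ℕ → ℕ) (i j : ℕ) : Prop :=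
  i < n ∧ ∃ e < m, X e = j ∧ L i e

/-- Agent `i` likes a good in the bundle of `j` that `j` likes as well. -/
def WantsLiked (n m : ℕ) (L : ℕ → ℕ → Prop) (X : ℕ → ℕ) (i j : ℕ) : Prop :=
  i < n ∧ ∃ e < m, X e = j ∧ L j e ∧ L i e

/-- The counts of liked goods are balanced along the paths of the relation `E`. -/
def BalancedAlong (n m : ℕ) (L : ℕ → ℕ → Prop) (w : ℕ → ℝ) (E : ℕ → ℕ → Prop) (X : ℕ → ℕ) : Prop :=
  ∀ i < n, ∀ j < n, Relation.ReflTransGen E i j →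
    (likedCount m L X j - 1) / w j ≤ likedCount m L X i / w i

/-! ### Counting liked goods, and balance under exchange along alternating paths -/

section Counting

variable {n m : ℕ} {L : ℕ → ℕ → Prop} {w : ℕ → ℝ} {k : ℝ} {X Y : ℕ → ℕ}

theorem sum_update_owner {m g : ℕ} (hg : g < m) (X : ℕ → ℕ) (a : ℕ) (f : ℕ → ℕ → ℝ) :
    ∑ e ∈ Finset.range m, f e (Function.update X g a e) =
      ∑ e ∈ Finset.range m, f e (X e) + f g a - f g (X g) := by
  have hmem : g ∈ Finset.range m := Finset.mem_range.2 hg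
  rw [← Finset.add_sum_erase _ _ hmem, ← Finset.add_sum_erase _ (fun e => f e (X e)) hmem]
  have : ∑ e ∈ (Finset.range m).erase g, f e (Function.update X g a e) =
      ∑ e ∈ (Finset.range m).erase g, f e (X e) := by
    refine Finset.sum_congr rfl fun e he => ?_
    rw [Function.update_of_ne (Finset.ne_of_mem_erase he)]
  rw [this]
  simp
  ring

open Classical in
theorem likedCount_update {g : ℕ} (hg : g < m) (X : ℕ → ℕ) (a j : ℕ) :
    likedCount m L (Function.update X g a) j = likedCount m L X j +
      (if a = j ∧ L j g then 1 else 0) - (if X g = j ∧ L j g then 1 else 0) :=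
  sum_update_owner hg X a fun e x => if x = j ∧ L j e then 1 else 0

open Classical in
theorem unlikedCount_update {g : ℕ} (hg : g < m) (X : ℕ → ℕ) (a j : ℕ) :
    unlikedCount m L (Function.update X g a) j = unlikedCount m L X j +
      (if a = j ∧ ¬ L j g then 1 else 0) - (if X g = j ∧ ¬ L j g then 1 else 0) :=
  sum_update_owner hg X a fun e x => if x = j ∧ ¬ L j e then 1 else 0

theorem likedCount_nonneg (j : ℕ) : 0 ≤ likedCount m L X j := by
  classical
  exact Finset.sum_nonneg fun e _ => by split_ifs <;> norm_num

theorem unlikedCount_nonneg (j : ℕ) : 0 ≤ unlikedCount m L X j := by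
  classical
  exact Finset.sum_nonneg fun e _ => by split_ifs <;> norm_num

theorem one_le_unlikedCount {e : ℕ} (he : e < m) (h : ¬ L (X e) e) :
    1 ≤ unlikedCount m L X (X e) := by
  classical
  have := Finset.single_le_sum (f := fun e' => if X e' = X e ∧ ¬ L (X e) e' then (1 : ℝ) else 0)
    (fun e' _ => by split_ifs <;> norm_num) (Finset.mem_range.2 he)
  simpa [h, unlikedCount] using this

theorem exists_of_likedCount_pos {j : ℕ} (h : 0 < likedCount m L X j) :
    ∃ e < m, X e = j ∧ L j e := by
  classical
  by_contra! hn
  refine h.ne' (Finset.sum_eq_zero fun e he => if_neg fun h' => ?_)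
  exact hn e (Finset.mem_range.1 he) h'.1 h'.2

theorem unlikedCount_eq_zero {j : ℕ} (h : ∀ e < m, X e = j → L j e) :
    unlikedCount m L X j = 0 := by
  classical
  exact Finset.sum_eq_zero fun e he => if_neg fun h' => h'.2 (h e (Finset.mem_range.1 he) h'.1)

theorem ownValue_nonneg (hk : 1 < k) (j : ℕ) : 0 ≤ ownValue m L k X j :=
  add_nonneg (mul_nonneg (by linarith) (likedCount_nonneg j)) (unlikedCount_nonneg j)

theorem likedCount_le_ownValue (hk : 1 < k) (j : ℕ) :
    likedCount m L X j ≤ ownValue m L k X j := by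
  have h1 := likedCount_nonneg (m := m) (L := L) (X := X) j
  have h2 := unlikedCount_nonneg (m := m) (L := L) (X := X) j
  unfold ownValue
  nlinarith

/-- Balance is kept if one more good is given to an agent `t` of least load in the upstream closed
set `R`, and goods are exchanged along an alternating path that starts at `t`. -/
theorem BalancedAlong.augment (hw : ∀ i < n, 0 < w i) {t : ℕ} {R : ℕ → Prop}
    (hR : ∀ i i', Wants n m L X i i' → R i' → R i) (htn : t < n) (ht : R t)
    (hmin : ∀ i < n, R i → likedCount m L X t / w t ≤ likedCount m L X i / w i)
    (hch : ∀ g < m, Y g ≠ X g → R (X g) ∧ Relation.ReflTransGen (Wants n m L X) t (Y g))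
    (hcnt : ∀ j < n, likedCount m L Y j = likedCount m L X j + if j = t then 1 else 0)
    (hX : BalancedAlong n m L w (Wants n m L X) X) :
    BalancedAlong n m L w (Wants n m L Y) Y := by
  have hRstar : ∀ i j, Relation.ReflTransGen (Wants n m L X) i j → R j → R i := by
    intro i j h
    induction h using Relation.ReflTransGen.head_induction_on with
    | refl => exact id
    | head h _ ih => exact fun hj => hR _ _ h (ih hj)
  -- A new edge uses an exchanged good. Its old owner lies in `R`, hence so does the agent who wants
  -- it, and its new owner was already reachable from `t`. So a new path is either an old one or
  -- splits into these two facts.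
  have key : ∀ i j, Relation.ReflTransGen (Wants n m L Y) i j →
      Relation.ReflTransGen (Wants n m L X) i j ∨
        (R i ∧ Relation.ReflTransGen (Wants n m L X) t j) := by
    intro i j h
    induction h using Relation.ReflTransGen.head_induction_on with
    | refl => exact Or.inl .refl
    | @head a c hac _ ih =>
      obtain ⟨ha, e, he, hY, hL⟩ := hac
      by_cases hc : Y e = X e
      · have hold : Wants n m L X a c := ⟨ha, e, he, hc ▸ hY, hL⟩
        rcases ih with ih | ⟨hc', ih⟩
        · exact Or.inl (.head hold ih)
        · exact Or.inr ⟨hR _ _ hold hc', ih⟩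
      · obtain ⟨h1, h2⟩ := hch e he hc
        have haR : R a := hR _ _ ⟨ha, e, he, rfl, hL⟩ h1
        rcases ih with ih | ⟨_, ih⟩
        · exact Or.inr ⟨haR, (hY ▸ h2).trans ih⟩
        · exact Or.inr ⟨haR, ih⟩
  intro i hi j hj hij
  have hle : likedCount m L X i / w i ≤ likedCount m L Y i / w i := by
    rw [hcnt i hi]
    have := hw i hi
    gcongr
    split_ifs <;> simp
  refine le_trans ?_ hle
  -- For `j = t` the subtracted good cancels the gain and minimality of `t` on `R` suffices.
  -- Otherwise a path that is not old is replaced by the old path from `t` to `j`, followed by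
  -- minimality of `t`.
  by_cases hjt : j = t
  · subst hjt
    rw [hcnt j hj, if_pos rfl, add_sub_cancel_right]
    rcases key i j hij with h | ⟨h, _⟩
    · exact hmin i hi (hRstar _ _ h ht)
    · exact hmin i hi h
  · rw [hcnt j hj, if_neg hjt, add_zero]
    rcases key i j hij with h | ⟨h, h'⟩
    · exact hX i hi j hj h
    · exact (hX t htn j hj h').trans (hmin i hi h)

theorem BalancedAlong.mono {E E' : ℕ → ℕ → Prop} (h : ∀ i j, E' i j → E i j)
    (hX : BalancedAlong n m L w E X) : BalancedAlong n m L w E' X :=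
  fun i hi j hj hij => hX i hi j hj (Relation.ReflTransGen.mono h _ _ hij)

theorem likedCount_congr {j : ℕ} (h : ∀ g < m, X g = j ↔ Y g = j) :
    likedCount m L X j = likedCount m L Y j := by
  classical
  refine Finset.sum_congr rfl fun e he => ?_
  simp only [h e (Finset.mem_range.1 he)]

/-- Goods without a proper owner do not matter for balance. -/
theorem BalancedAlong.congr (h : ∀ g < m, X g < n ∨ Y g < n → X g = Y g)
    (hX : BalancedAlong n m L w (Wants n m L X) X) :
    BalancedAlong n m L w (Wants n m L Y) Y := by
  have hpath : ∀ i j, j < n → Relation.ReflTransGen (Wants n m L Y) i j →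
      i < n ∧ Relation.ReflTransGen (Wants n m L X) i j := by
    intro i j hj hij
    induction hij using Relation.ReflTransGen.head_induction_on with
    | refl => exact ⟨hj, .refl⟩
    | @head a c hac _ ih =>
      obtain ⟨ha, e, he, hY, hL⟩ := hac
      exact ⟨ha, .head ⟨ha, e, he, (h e he (Or.inr (hY ▸ ih.1))).trans hY, hL⟩ ih.2⟩
  have hcnt : ∀ j < n, likedCount m L Y j = likedCount m L X j := fun j hj =>
    likedCount_congr fun g hg =>
      ⟨fun hh => (h g hg (Or.inr (hh ▸ hj))).trans hh,
        fun hh => (h g hg (Or.inl (hh ▸ hj))).symm.trans hh⟩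
  intro i hi j hj hij
  rw [hcnt i hi, hcnt j hj]
  exact hX i hi j hj (hpath i j hj hij).2

end Counting

/-! ### The price invariant and its preservation under redistribution -/

/-- The invariant of the final redistribution. The prices behind it are `k` for the liked goods of
the agents outside `U` and `1` for all other goods. -/
structure PricedInvariant (n m : ℕ) (L : ℕ → ℕ → Prop) (k : ℝ) (w : ℕ → ℝ) (U : ℕ → Prop)
    (X : ℕ → ℕ) : Prop where
  owner_lt : ∀ e < m, X e < n
  balanced : BalancedAlong n m L w (WantsLiked n m L X) X
  pure : ∀ e < m, U (X e) → L (X e) e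
  closed : ∀ i < n, ∀ e < m, U (X e) → L i e → U i
  cheap : ∀ i < n, ∀ e < m, ¬ L (X e) e → L i e → U i
  top : ∀ u < n, U u → ∀ j < n, (likedCount m L X j - 1) / w j ≤ likedCount m L X u / w u
  fair_out : ∀ e < m, ¬ L (X e) e → ∀ i < n, ¬ U i →
    (ownValue m L k X (X e) - 1) / w (X e) ≤ ownValue m L k X i / w i
  fair_in : ∀ e < m, ¬ L (X e) e → ∀ u < n, U u →
    (ownValue m L k X (X e) - 1) / w (X e) ≤ likedCount m L X u / w u

namespace PricedInvariant

variable {n m : ℕ} {L : ℕ → ℕ → Prop} {w : ℕ → ℝ} {k : ℝ} {U : ℕ → Prop} {X : ℕ → ℕ}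

/-- Keeps the poor agent `t` out of `U`: by `top`, a member of `U` has liked load at least
`(likedCount u - 1) / w u`, whereas already the whole value of `t` falls short of that. -/
theorem false_of_poor (hk : 1 < k) (hw : ∀ i < n, 0 < w i) {t u : ℕ} (ht : t < n)
    (hu : ownValue m L k X t / w t < (likedCount m L X u - 1) / w u)
    (h : (likedCount m L X u - 1) / w u ≤ likedCount m L X t / w t) : False := by
  have h2 : likedCount m L X t / w t ≤ ownValue m L k X t / w t := by
    have := hw t ht
    gcongr
    exact likedCount_le_ownValue hk t
  linarith

/-- All agents from which `u` can be reached may be added to `U`, if `u` has the largest load and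
the load is too large in comparison with the poorest agent `t`. -/
theorem enlarge (hk : 1 < k) (hw : ∀ i < n, 0 < w i) (h : PricedInvariant n m L k w U X)
    {t u : ℕ} (ht : t < n) (hun : u < n)
    (hu : ∀ j < n, (likedCount m L X j - 1) / w j ≤ (likedCount m L X u - 1) / w u)
    (hlt : ownValue m L k X t / w t < (likedCount m L X u - 1) / w u) :
    PricedInvariant n m L k w
      (fun i => U i ∨ Relation.ReflTransGen (WantsLiked n m L X) i u) X := by
  have htU : ¬ U t := fun hh => false_of_poor hk hw ht hlt (h.top t ht hh u hun)
  have hup : ∀ i < n, Relation.ReflTransGen (WantsLiked n m L X) i u →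
      ownValue m L k X t / w t < likedCount m L X i / w i := fun i hi hiu =>
    hlt.trans_le (h.balanced i hi u hun hiu)
  -- If an agent upstream of `u` held a good she does not like, `fair_out` against `t ∉ U` would
  -- bound her value less one by that of `t`. Her liked load would then be no larger than the value
  -- of `t`, against `hup`.
  have hpure : ∀ e < m, Relation.ReflTransGen (WantsLiked n m L X) (X e) u → L (X e) e := by
    intro e he hr
    by_contra hL
    have h1 := h.fair_out e he hL t ht htU
    have h2 := hup _ (h.owner_lt e he) hr
    have h3 : likedCount m L X (X e) / w (X e) ≤ (ownValue m L k X (X e) - 1) / w (X e) := by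
      have := hw _ (h.owner_lt e he)
      have h4 := one_le_unlikedCount he hL
      have h5 := likedCount_nonneg (m := m) (L := L) (X := X) (X e)
      gcongr
      unfold ownValue
      nlinarith
    linarith
  refine ⟨h.owner_lt, h.balanced, ?_, ?_, ?_, ?_, ?_, ?_⟩
  · rintro e he (hh | hh)
    · exact h.pure e he hh
    · exact hpure e he hh
  · rintro i hi e he (hh | hh) hL
    · exact Or.inl (h.closed i hi e he hh hL)
    · exact Or.inr (.head ⟨hi, e, he, rfl, hpure e he hh, hL⟩ hh)
  · exact fun i hi e he h1 h2 => Or.inl (h.cheap i hi e he h1 h2)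
  · rintro i hi (hh | hh) j hj
    · exact h.top i hi hh j hj
    · exact (hu j hj).trans (h.balanced i hi u hun hh)
  · exact fun e he hL i hi hU => h.fair_out e he hL i hi fun hh => hU (Or.inl hh)
  · rintro e he hL i hi (hh | hh)
    · exact h.fair_in e he hL i hi hh
    -- A newcomer to `U` is compared through `t`: the bound that held for `t` lies strictly below
    -- her liked load.
    · exact (h.fair_out e he hL t ht htU).trans (hup i hi hh).le

/-- The effect of moving a good from `u` to `t` on the liked and unliked counts. -/
theorem likedCount_move {g t u : ℕ} (hg : g < m) (hXg : X g = u) (hLu : L u g)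
    (hLt : ¬ L t g) (j : ℕ) :
    likedCount m L (Function.update X g t) j = likedCount m L X j - if j = u then 1 else 0 := by
  rw [likedCount_update hg, if_neg (by rintro ⟨rfl, h⟩; exact hLt h), add_zero, hXg]
  congr 1
  by_cases h : j = u
  · subst h; simp [hLu]
  · simp [h, Ne.symm h]

theorem ownValue_move {g t u : ℕ} (hg : g < m) (hXg : X g = u) (hLu : L u g)
    (hLt : ¬ L t g) (j : ℕ) :
    ownValue m L k (Function.update X g t) j =
      ownValue m L k X j - (if j = u then k else 0) + if j = t then 1 else 0 := by
  unfold ownValue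
  rw [likedCount_move hg hXg hLu hLt, unlikedCount_update hg, hXg,
    if_neg (by rintro ⟨rfl, h⟩; exact h hLu : ¬ (u = j ∧ ¬ L j g))]
  by_cases h : j = u
  · by_cases h' : j = t
    · exact absurd hLu (h ▸ h' ▸ hLt)
    · simp [h, (h ▸ h' : u ≠ t), Ne.symm (h ▸ h' : u ≠ t)]; ring
  · by_cases h' : j = t
    · subst h'; simp [h, hLt]; ring
    · simp [h, h', Ne.symm h']

/-- One step of the redistribution: a good of an agent `u` with the largest load goes to a poorest
agent `t`. -/
theorem move (hk : 1 < k) (hw : ∀ i < n, 0 < w i) (h : PricedInvariant n m L k w U X)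
    {t u g : ℕ} (ht : t < n) (hun : u < n)
    (htmin : ∀ i < n, ownValue m L k X t / w t ≤ ownValue m L k X i / w i)
    (hu : ∀ j < n, (likedCount m L X j - 1) / w j ≤ (likedCount m L X u - 1) / w u)
    (hlt : ownValue m L k X t / w t < (likedCount m L X u - 1) / w u)
    (hg : g < m) (hXg : X g = u) :
    L u g ∧ ¬ L t g ∧ ∃ V, PricedInvariant n m L k w V (Function.update X g t) := by
  have h' := h.enlarge hk hw ht hun hu hlt
  set V : ℕ → Prop := fun i => U i ∨ Relation.ReflTransGen (WantsLiked n m L X) i u with hV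
  have hVu : V u := Or.inr .refl
  have htV : ¬ V t := fun hh => false_of_poor hk hw ht hlt (h'.top t ht hh u hun)
  have hLu : L u g := hXg ▸ h'.pure g hg (hXg ▸ hVu)
  have hLt : ¬ L t g := fun hh => htV (h'.closed t ht g hg (hXg ▸ hVu) hh)
  have hut : u ≠ t := fun hh => htV (hh ▸ hVu)
  have hcnt := likedCount_move hg hXg hLu hLt
  have hval := ownValue_move (k := k) hg hXg hLu hLt
  -- The moved good is not liked by its new owner, so the relation only loses edges and old balance
  -- can be reused.
  have hwants : ∀ i j, WantsLiked n m L (Function.update X g t) i j → WantsLiked n m L X i j := by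
    rintro i j ⟨hi, e, he, h1, h2, h3⟩
    by_cases heg : e = g
    · subst heg
      rw [Function.update_self] at h1
      exact absurd (h1 ▸ h2) hLt
    · rw [Function.update_of_ne heg] at h1
      exact ⟨hi, e, he, h1, h2, h3⟩
  have hle : ∀ j < n, (likedCount m L (Function.update X g t) j - 1) / w j ≤
      (likedCount m L X j - 1) / w j := by
    intro j hj
    have := hw j hj
    rw [hcnt]
    gcongr
    split_ifs <;> linarith
  have hself : likedCount m L (Function.update X g t) u / w u = (likedCount m L X u - 1) / w u := by
    rw [hcnt, if_pos rfl]
  have hother : ∀ j, j ≠ u →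
      likedCount m L (Function.update X g t) j = likedCount m L X j := by
    intro j hj
    rw [hcnt, if_neg hj, sub_zero]
  have hvt : ownValue m L k (Function.update X g t) t = ownValue m L k X t + 1 := by
    rw [hval, if_neg hut.symm, if_pos rfl]; ring
  have hvo : ∀ j, j ≠ u → j ≠ t →
      ownValue m L k (Function.update X g t) j = ownValue m L k X j := by
    intro j h1 h2
    rw [hval, if_neg h1, if_neg h2]; ring
  have hvge : ∀ i < n, ¬ V i →
      ownValue m L k X i / w i ≤ ownValue m L k (Function.update X g t) i / w i := by
    intro i hi hiV
    have hiu : i ≠ u := fun hh => hiV (hh ▸ hVu)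
    have := hw i hi
    gcongr
    rw [hval, if_neg hiu]
    split_ifs <;> linarith
  refine ⟨hLu, hLt, V, ⟨?_, ?_, ?_, ?_, ?_, ?_, ?_, ?_⟩⟩
  · intro e he
    by_cases heg : e = g
    · subst heg; rw [Function.update_self]; exact ht
    · rw [Function.update_of_ne heg]; exact h'.owner_lt e he
  · intro i hi j hj hij
    refine (hle j hj).trans ?_
    -- Only `u` loses a liked good. Her new liked load is the old one up to one good, which by the
    -- choice of `u` still dominates everyone's load up to one good.
    by_cases hiu : i = u
    · rw [hiu, hself]; exact hu j hj
    · rw [hother i hiu]; exact h'.balanced i hi j hj (Relation.ReflTransGen.mono hwants _ _ hij)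
  · intro e he
    by_cases heg : e = g
    · subst heg; rw [Function.update_self]; exact fun hh => absurd hh htV
    · rw [Function.update_of_ne heg]; exact h'.pure e he
  · intro i hi e he
    by_cases heg : e = g
    · subst heg; rw [Function.update_self]; exact fun hh => absurd hh htV
    · rw [Function.update_of_ne heg]; exact h'.closed i hi e he
  · intro i hi e he
    by_cases heg : e = g
    -- The moved good becomes disliked by its owner, but whoever likes it wanted a good of `u` and
    -- is therefore already in `V`.
    · subst heg; intro _ hL; exact h'.closed i hi e he (hXg ▸ hVu) hL
    · rw [Function.update_of_ne heg]; exact h'.cheap i hi e he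
  · intro i hi hiV j hj
    refine (hle j hj).trans ?_
    by_cases hiu : i = u
    · rw [hiu, hself]; exact hu j hj
    · rw [hother i hiu]; exact h'.top i hi hiV j hj
  · intro e he hL i hi hiV
    refine le_trans ?_ (hvge i hi hiV)
    by_cases heg : e = g
    · subst heg
      rw [Function.update_self, hvt, add_sub_cancel_right]
      exact htmin i hi
    · rw [Function.update_of_ne heg] at hL ⊢
      have hXu : X e ≠ u := fun hh => hL (h'.pure e he (hh ▸ hVu))
      by_cases hXt : X e = t
      · rw [hXt, hvt, add_sub_cancel_right]; exact htmin i hi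
      · rw [hvo _ hXu hXt]; exact h'.fair_out e he hL i hi hiV
  · intro e he hL i hi hiV
    have hi' : (likedCount m L X u - 1) / w u ≤
        likedCount m L (Function.update X g t) i / w i := by
      by_cases hiu : i = u
      · rw [hiu, hself]
      · rw [hother i hiu]; exact h'.top i hi hiV u hun
    by_cases hXt : Function.update X g t e = t
    · rw [hXt, hvt, add_sub_cancel_right]; linarith
    · have heg : e ≠ g := by
        rintro rfl
        exact hXt (Function.update_self ..)
      rw [Function.update_of_ne heg] at hL hXt ⊢
      have hXu : X e ≠ u := fun hh => hL (h'.pure e he (hh ▸ hVu))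
      rw [hvo _ hXu hXt]
      linarith [h'.fair_out e he hL t ht htV]

end PricedInvariant

/-! ### From the price invariant to WEFX and fPO -/

namespace BivaluedInstance

variable {n m : ℕ} {L : ℕ → ℕ → Prop} {w : ℕ → ℝ} {U : ℕ → Prop} {X : ℕ → ℕ}

open Classical in
theorem value_bundle (I : BivaluedInstance n m) (Y : Fin m → Fin n)
    (hY : ∀ e : Fin m, X e = Y e) (hv : ∀ i e, I.v i e = if L i e then I.k else 1) (i : Fin n) :
    I.value i (bundle Y i) = ownValue m L I.k X i := by
  unfold value bundle ownValue likedCount unlikedCount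
  rw [Finset.sum_filter, Finset.mul_sum, ← Finset.sum_add_distrib, Finset.sum_range]
  refine Finset.sum_congr rfl fun e _ => ?_
  have : Y e = i ↔ X e = i := by rw [hY, Fin.ext_iff]
  rw [hv]
  by_cases h1 : X e = i <;> by_cases h2 : L i e <;> simp [this, h1, h2]

theorem value_erase (I : BivaluedInstance n m) (i : Fin n) {S : Finset (Fin m)} {e : Fin m}
    (he : e ∈ S) : I.value i (S.erase e) = I.value i S - I.v i e := by
  unfold value
  rw [← Finset.add_sum_erase S _ he]
  ring

theorem value_le_mul_value (I : BivaluedInstance n m) {i j : Fin n} {S : Finset (Fin m)} {c : ℝ}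
    (h : ∀ e ∈ S, I.v i e ≤ c * I.v j e) : I.value i S ≤ c * I.value j S := by
  unfold value
  rw [Finset.mul_sum]
  exact Finset.sum_le_sum h

theorem one_le_v (I : BivaluedInstance n m) (i : Fin n) (e : Fin m) : 1 ≤ I.v i e := by
  rcases I.v_mem i e with h | h <;> rw [h]
  exact I.one_lt_k.le

theorem v_le_k (I : BivaluedInstance n m) (i : Fin n) (e : Fin m) : I.v i e ≤ I.k := by
  rcases I.v_mem i e with h | h <;> rw [h]
  exact I.one_lt_k.le

/-- Three sources of fairness. If `j` holds a good she does not like, `fair_in` (scaled by `k`) or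
`fair_out` applies, according to whether `i ∈ U`; in the second case `cheap` makes `v i ≤ v j` on
the bundle. If `j` likes her whole bundle and `i` likes some of it, there is an edge from `i` to `j`
and balance applies. If `i` likes none of it, she counts every good as `1` and `hfin` is exactly
what is needed. -/
theorem wefx_of_pricedInvariant (I : BivaluedInstance n m) (Y : Fin m → Fin n)
    (hY : ∀ e : Fin m, X e = Y e) (hv : ∀ (i : Fin n) (e : Fin m), L i e → I.v i e = I.k)
    (hv' : ∀ (i : Fin n) (e : Fin m), ¬ L i e → I.v i e = 1)
    (hwI : ∀ i : Fin n, I.w i = w i)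
    (h : PricedInvariant n m L I.k w U X)
    (hfin : ∀ i < n, ∀ j < n, (likedCount m L X j - 1) / w j ≤ ownValue m L I.k X i / w i) :
    I.WEFX Y := by
  classical
  have hk := I.one_lt_k
  have hvite : ∀ (i : Fin n) (e : Fin m), I.v i e = if L i e then I.k else 1 := by
    intro i e
    split_ifs with hL
    · exact hv i e hL
    · exact hv' i e hL
  intro i j e he
  have hej : Y e = j := by simpa [bundle] using he
  have hXe : X e = j := by rw [hY, hej]
  have hmem : ∀ e' ∈ (bundle Y j).erase e, X e' = j := by
    intro e' he'
    rw [hY, show Y e' = j by simpa [bundle] using Finset.mem_of_mem_erase he']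
  have hwi := I.w_pos i
  have hwj := I.w_pos j
  have hval := I.value_bundle Y hY hvite
  have herase : I.value j ((bundle Y j).erase e) = ownValue m L I.k X j - I.v j e := by
    rw [I.value_erase j he, hval]
  have hown := likedCount_le_ownValue (m := m) (L := L) (X := X) hk (i : ℕ)
  have hkown : I.k * likedCount m L X i ≤ ownValue m L I.k X i := by
    have := unlikedCount_nonneg (m := m) (L := L) (X := X) i
    unfold ownValue
    linarith
  rw [ge_iff_le, hval]
  by_cases hp : ∃ e' : Fin m, X e' = j ∧ ¬ L j e'
  · obtain ⟨e', he', hL⟩ := hp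
    have hjU : ¬ U j := fun hh => hL (he' ▸ h.pure e' e'.2 (he' ▸ hh))
    have h1 : I.value j ((bundle Y j).erase e) ≤ ownValue m L I.k X j - 1 := by
      rw [herase]
      linarith [I.one_le_v j e]
    by_cases hiU : U i
    · have h2 := h.fair_in e' e'.2 (he' ▸ hL) i i.2 hiU
      rw [he', ← hwI, ← hwI] at h2
      have h3 : I.value i ((bundle Y j).erase e) ≤ I.k * I.value j ((bundle Y j).erase e) := by
        refine I.value_le_mul_value fun e₁ _ => ?_
        nlinarith [I.v_le_k i e₁, I.one_le_v j e₁]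
      calc I.value i ((bundle Y j).erase e) / I.w j
          ≤ (I.k * (ownValue m L I.k X j - 1)) / I.w j := by
            gcongr
            exact h3.trans (by gcongr)
        _ = I.k * ((ownValue m L I.k X j - 1) / I.w j) := by ring
        _ ≤ I.k * (likedCount m L X i / I.w i) := by gcongr
        _ = (I.k * likedCount m L X i) / I.w i := by ring
        _ ≤ _ := by gcongr
    · have h2 := h.fair_out e' e'.2 (he' ▸ hL) i i.2 hiU
      rw [he', ← hwI, ← hwI] at h2
      refine le_trans ?_ h2
      gcongr
      refine le_trans ?_ h1
      rw [← one_mul (I.value j _)]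
      refine I.value_le_mul_value fun e₁ he₁ => ?_
      rw [one_mul]
      by_cases hL₁ : L j e₁
      · rw [hv j e₁ hL₁]; exact I.v_le_k i e₁
      · have : ¬ L i e₁ := fun hh =>
          hiU (h.cheap i i.2 e₁ e₁.2 ((hmem e₁ he₁).symm ▸ hL₁) hh)
        rw [hv' j e₁ hL₁, hv' i e₁ this]
  · push Not at hp
    have hzero : unlikedCount m L X j = 0 :=
      unlikedCount_eq_zero fun e' he' hh => hp ⟨e', he'⟩ hh
    have hjval : I.value j ((bundle Y j).erase e) = I.k * (likedCount m L X j - 1) := by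
      rw [herase, ownValue, hzero, hv j e (hp e hXe)]
      ring
    by_cases hd : ∃ e' : Fin m, X e' = j ∧ L i e'
    · obtain ⟨e', he', hL⟩ := hd
      have h2 := h.balanced i i.2 j j.2 (.single ⟨i.2, e', e'.2, he', hp e' he', hL⟩)
      rw [← hwI, ← hwI] at h2
      have h3 : I.value i ((bundle Y j).erase e) ≤ 1 * I.value j ((bundle Y j).erase e) := by
        refine I.value_le_mul_value fun e₁ he₁ => ?_
        rw [one_mul, hv j e₁ (hp e₁ (hmem e₁ he₁))]
        exact I.v_le_k i e₁
      rw [one_mul, hjval] at h3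
      calc I.value i ((bundle Y j).erase e) / I.w j
          ≤ (I.k * (likedCount m L X j - 1)) / I.w j := by gcongr
        _ = I.k * ((likedCount m L X j - 1) / I.w j) := by ring
        _ ≤ I.k * (likedCount m L X i / I.w i) := by gcongr
        _ = (I.k * likedCount m L X i) / I.w i := by ring
        _ ≤ _ := by gcongr
    · push Not at hd
      have h2 := hfin i i.2 j j.2
      rw [← hwI, ← hwI] at h2
      refine le_trans ?_ h2
      gcongr
      have h3 : I.value i ((bundle Y j).erase e) ≤ I.k⁻¹ * I.value j ((bundle Y j).erase e) := by
        refine I.value_le_mul_value fun e₁ he₁ => ?_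
        rw [hv j e₁ (hp e₁ (hmem e₁ he₁)), hv' i e₁ (hd e₁ (hmem e₁ he₁)),
          inv_mul_cancel₀ (by linarith)]
      rwa [hjval, inv_mul_cancel_left₀ (by linarith)] at h3

/-- An allocation is fPO if every agent receives only goods with the best ratio of value to
price. -/
theorem fpo_of_prices (I : BivaluedInstance n m) (Y : Fin m → Fin n) (p : Fin m → ℝ)
    (α : Fin n → ℝ) (hα : ∀ i, 0 < α i) (hle : ∀ i e, α i * I.v i e ≤ p e)
    (heq : ∀ e, α (Y e) * I.v (Y e) e = p e) : I.FPO Y := by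
  rintro ⟨y, ⟨hy0, hy1⟩, hdom, j, hj⟩
  have h1 : ∑ i, α i * I.value i (bundle Y i) = ∑ e, p e := by
    unfold value bundle
    simp_rw [Finset.mul_sum, Finset.sum_filter]
    rw [Finset.sum_comm]
    refine Finset.sum_congr rfl fun e _ => ?_
    simp [heq]
  have h2 : ∑ i, α i * I.fracValue i y ≤ ∑ e, p e := by
    unfold fracValue
    simp_rw [Finset.mul_sum]
    rw [Finset.sum_comm]
    refine Finset.sum_le_sum fun e _ => ?_
    calc ∑ i, α i * (y i e * I.v i e) ≤ ∑ i, y i e * p e := by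
          refine Finset.sum_le_sum fun i _ => ?_
          have := mul_le_mul_of_nonneg_left (hle i e) (hy0 i e)
          linarith
      _ = p e := by rw [← Finset.sum_mul, hy1, one_mul]
  have h3 : ∑ i, α i * I.value i (bundle Y i) < ∑ i, α i * I.fracValue i y :=
    Finset.sum_lt_sum (fun i _ => mul_le_mul_of_nonneg_left (hdom i) (hα i).le)
      ⟨j, Finset.mem_univ j, mul_lt_mul_of_pos_left hj (hα j)⟩
  linarith

/-- The multiplier is `1/k` on `U` and `1` elsewhere. By `pure`, goods held in `U` get price `1`;
`closed` and `cheap` prevent an agent outside `U` from valuing a good of price `1` at `k`. -/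
theorem fpo_of_pricedInvariant (I : BivaluedInstance n m) (Y : Fin m → Fin n)
    (hY : ∀ e : Fin m, X e = Y e) (hv : ∀ (i : Fin n) (e : Fin m), L i e → I.v i e = I.k)
    (hv' : ∀ (i : Fin n) (e : Fin m), ¬ L i e → I.v i e = 1)
    (h : PricedInvariant n m L I.k w U X) : I.FPO Y := by
  classical
  have hk := I.one_lt_k
  have hk0 : 0 < I.k := by linarith
  refine I.fpo_of_prices Y (fun e => (if U (Y e) then I.k⁻¹ else 1) * I.v (Y e) e)
    (fun i => if U i then I.k⁻¹ else 1) (fun i => ?_) (fun i e => ?_) fun e => rfl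
  · split_ifs
    · exact inv_pos.2 hk0
    · exact one_pos
  · have hU : U (Y e) → I.v (Y e) e = I.k := fun hh =>
      hv _ _ (hY e ▸ h.pure e e.2 (hY e ▸ hh))
    have hcl : U (Y e) → ¬ U i → I.v i e = 1 := fun hh hi =>
      hv' _ _ fun hL => hi (h.closed i i.2 e e.2 (hY e ▸ hh) hL)
    by_cases h1 : U (Y e)
    · rw [if_pos h1, hU h1, inv_mul_cancel₀ hk0.ne']
      by_cases h2 : U i
      · rw [if_pos h2, inv_mul_le_iff₀ hk0, mul_one]
        exact I.v_le_k i e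
      · rw [if_neg h2, hcl h1 h2, one_mul]
    · rw [if_neg h1, one_mul]
      by_cases h2 : U i
      · rw [if_pos h2, inv_mul_le_iff₀ hk0]
        nlinarith [I.v_le_k i e, I.one_le_v (Y e) e]
      · rw [if_neg h2, one_mul]
        by_cases hL : L (Y e) e
        · rw [hv _ _ hL]; exact I.v_le_k i e
        · have : ¬ L i e := fun hh => h2 (h.cheap i i.2 e e.2 (hY e ▸ hL) hh)
          rw [hv' _ _ hL, hv' _ _ this]

end BivaluedInstance

/-! ### Inserting liked goods: labelled search and augmentation -/

/-- The goods below `e` have been given to agents who like them, or lie at position `n` if nobody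
likes them; the other goods lie at position `n + 1`. -/
structure LikedPartial (n m : ℕ) (L : ℕ → ℕ → Prop) (w : ℕ → ℝ) (e : ℕ) (X : ℕ → ℕ) : Prop where
  balanced : BalancedAlong n m L w (Wants n m L X) X
  done : ∀ g < e, g < m → (X g < n ∧ L (X g) g) ∨ (X g = n ∧ ∀ i < n, ¬ L i g)
  rest : ∀ g, e ≤ g → g < m → X g = n + 1

/-- The labels `rank` and `par` describe alternating paths that end at the position `n`. -/
structure SearchForest (n m : ℕ) (L : ℕ → ℕ → Prop) (X rank par : ℕ → ℕ) : Prop where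
  rank_source : rank n = 1
  rank_beyond : ∀ x, n < x → rank x = 0
  parent : ∀ a < n, 0 < rank a →
    par a < m ∧ L a (par a) ∧ 0 < rank (X (par a)) ∧ rank a = rank (X (par a)) + 1

/-- No further agent can be labelled. -/
def SearchClosed (n m : ℕ) (L : ℕ → ℕ → Prop) (X rank : ℕ → ℕ) : Prop :=
  ∀ a < n, ∀ g < m, L a g → 0 < rank (X g) → 0 < rank a

/-- The labels after the pairs (good, agent) before `(g, a)` have been scanned, where `rank₀` are
the labels at the start of the scan. -/
structure ScanState (n m : ℕ) (L : ℕ → ℕ → Prop) (X rank₀ : ℕ → ℕ) (g a : ℕ) (rank par : ℕ → ℕ) :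
    Prop where
  forest : SearchForest n m L X rank par
  mono : ∀ x, 0 < rank₀ x → 0 < rank x
  scanned : ∀ g' < m, ∀ a' < n, (g' < g ∨ g' = g ∧ a' < a) → L a' g' → 0 < rank₀ (X g') →
    0 < rank a'
  stable : SearchClosed n m L X rank₀ → ∀ x, 0 < rank x → 0 < rank₀ x

section Search

variable {n m : ℕ} {L : ℕ → ℕ → Prop} {w : ℕ → ℝ} {X rank par rank₀ : ℕ → ℕ}

theorem SearchForest.label {g a : ℕ} (h : SearchForest n m L X rank par) (hg : g < m) (ha : a < n)
    (hL : L a g) (h0 : rank a = 0) (hpos : 0 < rank (X g)) :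
    SearchForest n m L X (Function.update rank a (rank (X g) + 1)) (Function.update par a g) := by
  have hne : ∀ x, 0 < rank x → Function.update rank a (rank (X g) + 1) x = rank x := by
    intro x hx
    refine Function.update_of_ne ?_ _ _
    rintro rfl
    omega
  refine ⟨?_, ?_, ?_⟩
  · rw [Function.update_of_ne (by omega)]; exact h.rank_source
  · intro x hx
    rw [Function.update_of_ne (by omega)]; exact h.rank_beyond x hx
  · intro b hb hbpos
    by_cases hba : b = a
    · subst hba
      rw [Function.update_self, Function.update_self, hne _ hpos]
      exact ⟨hg, hL, hpos, rfl⟩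
    · rw [Function.update_of_ne hba] at hbpos ⊢
      rw [Function.update_of_ne hba]
      obtain ⟨h1, h2, h3, h4⟩ := h.parent b hb hbpos
      rw [hne _ h3]
      exact ⟨h1, h2, h3, h4⟩

/-- The scan works in place, so the owner of `g` may have received her label in this very scan.
`stable` survives because closed initial labels would already contain `a`. -/
theorem ScanState.step {g a : ℕ} (h : ScanState n m L X rank₀ g a rank par) (hg : g < m)
    (ha : a < n) (hL : L a g) (h0 : rank a = 0) (hpos : 0 < rank (X g)) :
    ScanState n m L X rank₀ g (a + 1) (Function.update rank a (rank (X g) + 1))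
      (Function.update par a g) := by
  have hge : ∀ x, 0 < rank x → 0 < Function.update rank a (rank (X g) + 1) x := by
    intro x hx
    rw [Function.update_apply]
    split_ifs <;> omega
  refine ⟨h.forest.label hg ha hL h0 hpos, fun x hx => hge x (h.mono x hx), ?_, ?_⟩
  · intro g' hg' a' ha' hlt hL' hp
    by_cases haa : a' = a
    · subst haa; simp
    · exact hge _ (h.scanned g' hg' a' ha' (by omega) hL' hp)
  · intro hc x hx
    by_cases hxa : x = a
    · subst hxa
      exact hc x ha g hg hL (h.stable hc _ hpos)
    · rw [Function.update_of_ne hxa] at hx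
      exact h.stable hc x hx

theorem ScanState.skip {g a : ℕ} (h : ScanState n m L X rank₀ g a rank par)
    (hno : ¬ (L a g ∧ rank a = 0 ∧ 0 < rank (X g))) :
    ScanState n m L X rank₀ g (a + 1) rank par := by
  refine ⟨h.forest, h.mono, ?_, h.stable⟩
  intro g' hg' a' ha' hlt hL' hp
  by_cases haa : g' = g ∧ a' = a
  · obtain ⟨rfl, rfl⟩ := haa
    by_contra h0
    exact hno ⟨hL', by omega, h.mono _ hp⟩
  · exact h.scanned g' hg' a' ha' (by omega) hL' hp

theorem ScanState.nextGood {g : ℕ} (h : ScanState n m L X rank₀ g n rank par) :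
    ScanState n m L X rank₀ (g + 1) 0 rank par :=
  ⟨h.forest, h.mono, fun g' hg' a' ha' hlt => h.scanned g' hg' a' ha' (by omega), h.stable⟩

theorem ScanState.init (h : SearchForest n m L X rank par) :
    ScanState n m L X rank 0 0 rank par :=
  ⟨h, fun _ => id, fun _ _ _ _ h => by omega, fun _ _ => id⟩

/-- After `r` scans, either the labels are closed or at least `r` agents are labelled. -/
def SearchProgress (n m : ℕ) (L : ℕ → ℕ → Prop) (X rank : ℕ → ℕ) (r : ℕ) : Prop :=
  SearchClosed n m L X rank ∨ r ≤ ((Finset.range n).filter fun a => 0 < rank a).card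

/-- A complete scan of labels that are not closed reaches a missing agent, so the set of labelled
agents grows strictly; closed labels gain nothing and stay closed. -/
theorem SearchProgress.next {r : ℕ} (hp : SearchProgress n m L X rank₀ r)
    (h : ScanState n m L X rank₀ m 0 rank par) : SearchProgress n m L X rank (r + 1) := by
  by_cases hc : SearchClosed n m L X rank₀
  · left
    intro a ha g hg hL hpos
    exact h.mono a (hc a ha g hg hL (h.stable hc _ hpos))
  · right
    have hr := hp.resolve_left hc
    unfold SearchClosed at hc
    push Not at hc
    obtain ⟨a, ha, g, hg, hL, hpos, h0⟩ := hc
    refine Nat.succ_le_of_lt (hr.trans_lt (Finset.card_lt_card ?_))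
    refine (Finset.ssubset_iff_of_subset ?_).2 ⟨a, ?_, ?_⟩
    · intro x hx
      simp only [Finset.mem_filter] at hx ⊢
      exact ⟨hx.1, h.mono x hx.2⟩
    · simp only [Finset.mem_filter, Finset.mem_range]
      exact ⟨ha, h.scanned g hg a ha (Or.inl hg) hL hpos⟩
    · simp only [Finset.mem_filter, not_and]
      exact fun _ => by omega

theorem SearchProgress.closed (hp : SearchProgress n m L X rank n) :
    SearchClosed n m L X rank := by
  refine hp.elim id fun h a ha _ _ _ _ => ?_
  have : (Finset.range n).filter (fun a => 0 < rank a) = Finset.range n :=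
    Finset.eq_of_subset_of_card_le (Finset.filter_subset _ _) (by simpa using h)
  have hm := Finset.mem_range.2 ha
  rw [← this] at hm
  exact (Finset.mem_filter.1 hm).2

/-- Following parents lowers the rank by exactly one, so all ranks `1, …, rank a` occur among the `n
+ 1` positions up to `n`. This bounds the length of an augmentation. -/
theorem SearchForest.rank_le (h : SearchForest n m L X rank par) {a : ℕ} (ha : a ≤ n) :
    rank a ≤ n + 1 := by
  have hpath : ∀ r x, x ≤ n → rank x = r → ∀ q, 1 ≤ q → q ≤ r → ∃ y ≤ n, rank y = q := by
    intro r
    induction r with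
    | zero => intro x _ _ q h1 h2; omega
    | succ r ih =>
      intro x hx hr q h1 h2
      rcases Nat.lt_or_ge q (r + 1) with hq | hq
      · rcases Nat.lt_or_ge x n with hxn | hxn
        · obtain ⟨_, _, h3, h4⟩ := h.parent x hxn (by omega)
          refine ih (X (par x)) ?_ (by omega) q h1 (by omega)
          by_contra hb
          have := h.rank_beyond _ (not_le.1 hb)
          omega
        · have : x = n := le_antisymm hx hxn
          have := h.rank_source
          subst x
          omega
      · exact ⟨x, hx, by omega⟩
  have hsub : Finset.Icc 1 (rank a) ⊆ (Finset.range (n + 1)).image rank := by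
    intro q hq
    obtain ⟨h1, h2⟩ := Finset.mem_Icc.1 hq
    obtain ⟨y, hy, hyq⟩ := hpath _ a ha rfl q h1 h2
    exact Finset.mem_image.2 ⟨y, Finset.mem_range.2 (by omega), hyq⟩
  have := (Finset.card_le_card hsub).trans Finset.card_image_le
  simpa using this

/-- The state of the augmentation: the good that `a` used to have is gone, and `a` is to get the
good `par a`. -/
structure AugmentState (n m : ℕ) (L : ℕ → ℕ → Prop) (X rank : ℕ → ℕ) (e t : ℕ) (Y : ℕ → ℕ)
    (a : ℕ) : Prop where
  le : a ≤ n
  reached : 0 < rank a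
  path : Relation.ReflTransGen (Wants n m L X) t a
  changed : ∀ g < m, Y g ≠ X g → Y g < n ∧ L (Y g) g ∧
    Relation.ReflTransGen (Wants n m L X) t (Y g) ∧ 0 < rank (X g) ∧ rank a ≤ rank (X g)
  count : ∀ j < n, likedCount m L Y j + (if j = a then 1 else 0) =
    likedCount m L X j + if j = t then 1 else 0
  source : a < n ∨ Y e ≠ X e

/-- The good `par a` has not been exchanged before: its owner in `X` has rank `rank a - 1`, while
the old owners of exchanged goods have rank at least `rank a`. Taking it settles the debt to `a` and
passes it to the former owner. If that is position `n`, the good must be `e`, the only good there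
that anyone may like. -/
theorem AugmentState.step {e t a : ℕ} {Y : ℕ → ℕ} (hf : SearchForest n m L X rank par)
    (hliked : ∀ g < m, X g < n → L (X g) g)
    (hsource : ∀ g < m, X g = n → g ≠ e → ∀ i < n, ¬ L i g)
    (h : AugmentState n m L X rank e t Y a) (ha : a < n) :
    AugmentState n m L X rank e t (Function.update Y (par a) a) (Y (par a)) ∧
      rank (Y (par a)) < rank a := by
  obtain ⟨hg, hL, hpos, hrank⟩ := hf.parent a ha h.reached
  have hYX : Y (par a) = X (par a) := by
    by_contra hne
    have := (h.changed _ hg hne).2.2.2.2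
    omega
  rw [hYX]
  have hb : X (par a) ≤ n := by
    by_contra hb
    have := hf.rank_beyond _ (not_le.1 hb)
    omega
  refine ⟨⟨hb, hpos, h.path.tail ⟨ha, _, hg, rfl, hL⟩, ?_, ?_, ?_⟩, by omega⟩
  · intro g' hg' hne
    by_cases hgg : g' = par a
    · subst hgg
      rw [Function.update_self]
      exact ⟨ha, hL, h.path, hpos, le_rfl⟩
    · rw [Function.update_of_ne hgg] at hne ⊢
      obtain ⟨h1, h2, h3, h4, h5⟩ := h.changed g' hg' hne
      exact ⟨h1, h2, h3, h4, by omega⟩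
  · intro j hj
    rw [likedCount_update hg, ← h.count j hj, hYX]
    have h1 : (X (par a) = j ∧ L j (par a)) ↔ j = X (par a) :=
      ⟨fun hh => hh.1.symm, fun hh => ⟨hh.symm, hh ▸ hliked _ hg (hh ▸ hj)⟩⟩
    have h2 : (a = j ∧ L j (par a)) ↔ j = a :=
      ⟨fun hh => hh.1.symm, fun hh => ⟨hh.symm, hh ▸ hL⟩⟩
    simp only [h1, h2]
    ring
  · by_cases hlt : X (par a) < n
    · exact Or.inl hlt
    · right
      have hn : X (par a) = n := by omega
      have hpe : par a = e := by
        by_contra hne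
        exact hsource _ hg hn hne a ha hL
      rw [← hpe, Function.update_self]
      omega

theorem AugmentState.init {e t : ℕ} (ht : t < n) (hr : 0 < rank t) :
    AugmentState n m L X rank e t X t :=
  ⟨ht.le, hr, .refl, fun _ _ h => absurd rfl h, fun _ _ => rfl, Or.inl ht⟩

/-- Position `n` is not an agent, so moving `e` there from `n + 1` does not affect balance; it only
makes `e` the root of the search. -/
theorem LikedPartial.place {e : ℕ} (h : LikedPartial n m L w e X) :
    BalancedAlong n m L w (Wants n m L (Function.update X e n)) (Function.update X e n) ∧
    (∀ g < m, Function.update X e n g < n → L (Function.update X e n g) g) ∧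
    (∀ g < m, Function.update X e n g = n → g ≠ e → ∀ i < n, ¬ L i g) := by
  have hcase : ∀ g < m, X g < n → g < e := by
    intro g hg hlt
    by_contra hge
    have := h.rest g (not_lt.1 hge) hg
    omega
  refine ⟨h.balanced.congr ?_, ?_, ?_⟩
  · intro g hg hor
    by_cases hge : g = e
    · subst hge
      rw [Function.update_self] at hor
      have := h.rest g le_rfl hg
      omega
    · rw [Function.update_of_ne hge]
  · intro g hg hlt
    by_cases hge : g = e
    · subst hge
      rw [Function.update_self] at hlt
      omega
    · rw [Function.update_of_ne hge] at hlt ⊢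
      rcases h.done g (hcase g hg hlt) hg with h1 | h1
      · exact h1.2
      · omega
  · intro g hg hn hge
    rw [Function.update_of_ne hge] at hn
    rcases Nat.lt_or_ge g e with hlt | hle
    · rcases h.done g hlt hg with h1 | h1
      · omega
      · exact h1.2
    · have := h.rest g hle hg
      omega

/-- An agent who likes `e` would be labelled from the root. Without labels nobody likes `e`, and it
rests at position `n`. -/
theorem LikedPartial.next_of_closed {e : ℕ} (h : LikedPartial n m L w e X) (he : e < m)
    (hf : SearchForest n m L (Function.update X e n) rank par)
    (hc : SearchClosed n m L (Function.update X e n) rank) (hnone : ∀ a < n, rank a = 0) :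
    LikedPartial n m L w (e + 1) (Function.update X e n) := by
  refine ⟨h.place.1, ?_, ?_⟩
  · intro g hg hgm
    by_cases hge : g = e
    · subst hge
      right
      refine ⟨Function.update_self .., fun i hi hL => ?_⟩
      have := hc i hi g hgm hL (by rw [Function.update_self, hf.rank_source]; exact one_pos)
      have := hnone i hi
      omega
    · rw [Function.update_of_ne hge]
      exact h.done g (by omega) hgm
  · intro g hg hgm
    rw [Function.update_of_ne (by omega)]
    exact h.rest g (by omega) hgm

/-- The labelled positions serve as the upstream closed set in `BalancedAlong.augment`. Goods still
at `n + 1` are untouched because that position has rank zero. -/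
theorem LikedPartial.next_of_augment {e t : ℕ} {Y : ℕ → ℕ} (hw : ∀ i < n, 0 < w i)
    (h : LikedPartial n m L w e X)
    (hf : SearchForest n m L (Function.update X e n) rank par)
    (hc : SearchClosed n m L (Function.update X e n) rank)
    (ht : t < n) (htr : 0 < rank t)
    (hmin : ∀ i < n, 0 < rank i → likedCount m L (Function.update X e n) t / w t ≤
      likedCount m L (Function.update X e n) i / w i)
    (hY : AugmentState n m L (Function.update X e n) rank e t Y n) :
    LikedPartial n m L w (e + 1) Y := by
  refine ⟨?_, ?_, ?_⟩
  · refine h.place.1.augment hw (R := fun x => 0 < rank x) ?_ ht htr hmin ?_ ?_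
    · rintro i i' ⟨hi, g, hg, rfl, hL⟩ hr
      exact hc i hi g hg hL hr
    · intro g hg hne
      obtain ⟨_, _, h3, h4, _⟩ := hY.changed g hg hne
      exact ⟨h4, h3⟩
    · intro j hj
      have := hY.count j hj
      rwa [if_neg (by omega : ¬ j = n), add_zero] at this
  · intro g hg hgm
    by_cases hne : Y g = Function.update X e n g
    · have hge : g ≠ e := by
        rintro rfl
        rcases hY.source with h1 | h1
        · omega
        · exact h1 hne
      rw [hne, Function.update_of_ne hge]
      exact h.done g (by omega) hgm
    · obtain ⟨h1, h2, _⟩ := hY.changed g hgm hne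
      exact Or.inl ⟨h1, h2⟩
  · intro g hg hgm
    have h1 := h.rest g (by omega) hgm
    by_contra hne
    have h2 := (hY.changed g hgm (by
      rw [Function.update_of_ne (by omega : g ≠ e), h1]; exact hne)).2.2.2.1
    rw [Function.update_of_ne (by omega : g ≠ e), h1, hf.rank_beyond _ (by omega)] at h2
    omega

end Search

/-! ### Goods that nobody likes -/

/-- All liked goods have been distributed, and the other goods below `e` as well. -/
structure FairPartial (n m : ℕ) (L : ℕ → ℕ → Prop) (k : ℝ) (w : ℕ → ℝ) (e : ℕ) (X : ℕ → ℕ) :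
    Prop where
  balanced : BalancedAlong n m L w (Wants n m L X) X
  owner_lt : ∀ g < e, g < m → X g < n
  liked : ∀ g < m, (X g < n ∧ L (X g) g) ∨ ∀ i < n, ¬ L i g
  fair : ∀ g < m, X g < n → ¬ L (X g) g → ∀ i < n,
    (ownValue m L k X (X g) - 1) / w (X g) ≤ ownValue m L k X i / w i

section Fair

variable {n m : ℕ} {L : ℕ → ℕ → Prop} {w : ℕ → ℝ} {k : ℝ} {X : ℕ → ℕ}

theorem LikedPartial.fairPartial (h : LikedPartial n m L w m X) : FairPartial n m L k w 0 X := by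
  refine ⟨h.balanced, by simp, fun g hg => ?_, fun g hg hlt hL => ?_⟩
  · rcases h.done g hg hg with h1 | h1
    · exact Or.inl h1
    · exact Or.inr h1.2
  · rcases h.done g hg hg with h1 | h1
    · exact absurd h1.2 hL
    · omega

theorem FairPartial.skip {e : ℕ} (h : FairPartial n m L k w e X) (he : X e < n) :
    FairPartial n m L k w (e + 1) X := by
  refine ⟨h.balanced, fun g hg hgm => ?_, h.liked, h.fair⟩
  by_cases hge : g = e
  · exact hge ▸ he
  · exact h.owner_lt g (by omega) hgm

/-- A good still without an owner is liked by nobody, so liked counts stay the same and no edges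
appear. After the gift the value of `t` less one is her old value, which was minimal. -/
theorem FairPartial.give (hw : ∀ i < n, 0 < w i) {e t : ℕ} (h : FairPartial n m L k w e X)
    (he : e < m) (hXe : n ≤ X e) (ht : t < n)
    (hmin : ∀ i < n, ownValue m L k X t / w t ≤ ownValue m L k X i / w i) :
    FairPartial n m L k w (e + 1) (Function.update X e t) ∧
    (∀ j < n, likedCount m L (Function.update X e t) j = likedCount m L X j) ∧
    ∀ j < n, ownValue m L k (Function.update X e t) j =
      ownValue m L k X j + if j = t then 1 else 0 := by
  have hno : ∀ i < n, ¬ L i e := (h.liked e he).resolve_left (by omega)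
  have hcnt : ∀ j < n, likedCount m L (Function.update X e t) j = likedCount m L X j := by
    intro j hj
    rw [likedCount_update he, if_neg fun hh => hno j hj hh.2, if_neg fun hh => hno j hj hh.2]
    ring
  have hval : ∀ j < n, ownValue m L k (Function.update X e t) j =
      ownValue m L k X j + if j = t then 1 else 0 := by
    intro j hj
    unfold ownValue
    rw [hcnt j hj, unlikedCount_update he, if_neg (by omega : ¬ (X e = j ∧ ¬ L j e))]
    simp only [hno j hj, not_false_eq_true, and_true, eq_comm (a := t)]
    ring
  refine ⟨⟨?_, ?_, ?_, ?_⟩, hcnt, hval⟩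
  · intro i hi j hj hij
    rw [hcnt i hi, hcnt j hj]
    refine h.balanced i hi j hj (Relation.ReflTransGen.mono ?_ _ _ hij)
    rintro a b ⟨ha, g, hg, hgb, hL⟩
    refine ⟨ha, g, hg, ?_, hL⟩
    rwa [Function.update_of_ne] at hgb
    rintro rfl
    exact hno a ha hL
  · intro g hg hgm
    by_cases hge : g = e
    · subst hge; rw [Function.update_self]; exact ht
    · rw [Function.update_of_ne hge]; exact h.owner_lt g (by omega) hgm
  · intro g hg
    by_cases hge : g = e
    · exact Or.inr (hge ▸ hno)
    · rw [Function.update_of_ne hge]; exact h.liked g hg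
  · intro g hg hlt hL i hi
    have hle : ownValue m L k X i / w i ≤ ownValue m L k (Function.update X e t) i / w i := by
      have := hw i hi
      gcongr
      rw [hval i hi]
      split_ifs <;> simp
    refine le_trans ?_ hle
    rw [hval _ hlt]
    by_cases hgt : Function.update X e t g = t
    · rw [if_pos hgt, hgt, add_sub_cancel_right]; exact hmin i hi
    · have hge : g ≠ e := by
        rintro rfl
        exact hgt (Function.update_self ..)
      rw [if_neg hgt, add_zero]
      rw [Function.update_of_ne hge] at hlt hL ⊢
      exact h.fair g hg hlt hL i hi

/-- Redistribution starts with `U` empty. `cheap` holds vacuously, since a good not liked by its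
owner is liked by nobody. -/
theorem FairPartial.pricedInvariant (h : FairPartial n m L k w m X) :
    PricedInvariant n m L k w (fun _ => False) X := by
  refine ⟨fun e he => h.owner_lt e he he, h.balanced.mono ?_, ?_, ?_, ?_, ?_, ?_, ?_⟩
  · rintro i j ⟨hi, e, he, h1, _, h3⟩
    exact ⟨hi, e, he, h1, h3⟩
  · exact fun _ _ hh => hh.elim
  · exact fun _ _ _ _ hh => hh.elim
  · exact fun i hi e he hL hLi =>
      (h.liked e he).elim (fun hh => hL hh.2) fun hh => hh i hi hLi
  · exact fun _ _ hh => hh.elim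
  · exact fun e he hL i hi _ => h.fair e he (h.owner_lt e he he) hL i hi
  · exact fun _ _ _ _ _ hh => hh.elim

end Fair

/-! ### Memory updates and cost-bounded reasoning about programs -/

namespace RealRAM

namespace Store

/-- Assignment to a natural-number variable. -/
def setN (s : Store) (x v : ℕ) : Store :=
  { s with natVar := Function.update s.natVar x v }

/-- Assignment to a cell of a natural-number array. -/
def putN (s : Store) (a i v : ℕ) : Store :=
  { s with natArr := Function.update s.natArr a (Function.update (s.natArr a) i v) }

/-- Assignment to a cell of a real array. -/
def putR (s : Store) (a i : ℕ) (v : ℝ) : Store :=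
  { s with realArr := Function.update s.realArr a (Function.update (s.realArr a) i v) }

variable (s : Store) (x y v a b i : ℕ) (r : ℝ)

@[simp] theorem natVar_setN : (s.setN x v).natVar y = if y = x then v else s.natVar y :=
  Function.update_apply ..

@[simp] theorem natArr_setN : (s.setN x v).natArr = s.natArr := rfl

@[simp] theorem realArr_setN : (s.setN x v).realArr = s.realArr := rfl

@[simp] theorem natVar_putN : (s.putN a i v).natVar = s.natVar := rfl

@[simp] theorem natArr_putN : (s.putN a i v).natArr b =
    if b = a then Function.update (s.natArr a) i v else s.natArr b :=
  Function.update_apply ..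

@[simp] theorem realArr_putN : (s.putN a i v).realArr = s.realArr := rfl

@[simp] theorem natVar_putR : (s.putR a i r).natVar = s.natVar := rfl

@[simp] theorem natArr_putR : (s.putR a i r).natArr = s.natArr := rfl

@[simp] theorem realArr_putR : (s.putR a i r).realArr b =
    if b = a then Function.update (s.realArr a) i r else s.realArr b :=
  Function.update_apply ..

end Store

/-- On input `inp`, the program `p`, started with memory `s`, halts after at most `T` steps with a
memory that satisfies `Q`. -/
def Ensures (inp : List ℝ) (p : Prog) (s : Store) (T : ℕ) (Q : Store → Prop) : Prop :=
  ∃ t s', Run inp p s t s' ∧ t ≤ T ∧ Q s'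

namespace Ensures

variable {inp : List ℝ} {p q : Prog} {s : Store} {T T' : ℕ} {Q Q' : Store → Prop}

theorem mono (h : Ensures inp p s T Q) (hT : T ≤ T') (hQ : ∀ s', Q s' → Q' s') :
    Ensures inp p s T' Q' := by
  obtain ⟨t, s', h1, h2, h3⟩ := h
  exact ⟨t, s', h1, h2.trans hT, hQ s' h3⟩

theorem seq (h : Ensures inp p s T fun s' => Ensures inp q s' T' Q) :
    Ensures inp (.seq p q) s (T + T') Q := by
  obtain ⟨t, s', h1, h2, t', s'', h3, h4, h5⟩ := h
  exact ⟨t + t', s'', .seq h1 h3, by omega, h5⟩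

theorem skip (h : Q s) : Ensures inp .skip s 1 Q := ⟨1, s, .skip s, le_rfl, h⟩

theorem setNat {x : ℕ} {e : NExp} (h : Q (s.setN x (e.eval s))) :
    Ensures inp (.setNat x e) s (e.cost + 1) Q :=
  ⟨_, _, .setNat x e s, le_rfl, h⟩

theorem putNat {a : ℕ} {i e : NExp} (h : Q (s.putN a (i.eval s) (e.eval s))) :
    Ensures inp (.putNat a i e) s (i.cost + e.cost + 1) Q :=
  ⟨_, _, .putNat a i e s, le_rfl, h⟩

theorem putReal {a : ℕ} {i : NExp} {r : RExp} (h : Q (s.putR a (i.eval s) (r.eval inp s))) :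
    Ensures inp (.putReal a i r) s (i.cost + r.cost + 1) Q :=
  ⟨_, _, .putReal a i r s, le_rfl, h⟩

theorem ite {b : BExp} (hp : b.Holds inp s → Ensures inp p s T Q)
    (hq : ¬ b.Holds inp s → Ensures inp q s T Q) :
    Ensures inp (.ite b p q) s (b.cost + 1 + T) Q := by
  by_cases hb : b.Holds inp s
  · obtain ⟨t, s', h1, h2, h3⟩ := hp hb
    exact ⟨_, s', .iteTrue hb h1, by omega, h3⟩
  · obtain ⟨t, s', h1, h2, h3⟩ := hq hb
    exact ⟨_, s', .iteFalse hb h1, by omega, h3⟩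

/-- A conditional without alternative. -/
theorem ite_skip {b : BExp} (hT : 1 ≤ T) (hp : b.Holds inp s → Ensures inp p s T Q)
    (hq : ¬ b.Holds inp s → Q s) :
    Ensures inp (.ite b p .skip) s (b.cost + 1 + T) Q :=
  ite hp fun h => (skip (hq h)).mono hT fun _ => id

/-- Loops with a decreasing measure. -/
theorem loop {b : BExp} (Inv : Store → Prop) (μ : Store → ℕ)
    (hbody : ∀ s, Inv s → b.Holds inp s → Ensures inp p s T fun s' => Inv s' ∧ μ s' < μ s) :
    ∀ (N : ℕ) (s : Store), Inv s → μ s ≤ N →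
      Ensures inp (.loop b p) s (N * (b.cost + 1 + T) + (b.cost + 1))
        fun s' => Inv s' ∧ ¬ b.Holds inp s' := by
  intro N
  induction N with
  | zero =>
    intro s hs hN
    by_cases hb : b.Holds inp s
    · obtain ⟨t, s', h1, h2, h3, h4⟩ := hbody s hs hb
      omega
    · exact ⟨_, s, .loopFalse hb, by omega, hs, hb⟩
  | succ N ih =>
    intro s hs hN
    by_cases hb : b.Holds inp s
    · obtain ⟨t, s', h1, h2, h3, h4⟩ := hbody s hs hb
      obtain ⟨t', s'', h5, h6, h7⟩ := ih s' h3 (by omega)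
      exact ⟨_, s'', .loopTrue hb h1 h5, by rw [Nat.succ_mul]; omega, h7⟩
    · exact ⟨_, s, .loopFalse hb, by omega, hs, hb⟩

end Ensures

/-- `for x = 0, …, N - 1 do p`, where `N` is the value of the variable `y`. -/
def Prog.forTo (x y : ℕ) (p : Prog) : Prog :=
  .seq (.setNat x (.const 0))
    (.loop (.natLt (.var x) (.var y)) (.seq p (.setNat x (.add (.var x) (.const 1)))))

/-- The invariant is demanded after the counter has been advanced, so invariants may be phrased for
the memory at the next loop test; `hN` keeps the upper limit fixed. -/
theorem Ensures.forTo {inp : List ℝ} {p : Prog} {s : Store} {x y N T : ℕ}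
    (Inv : ℕ → Store → Prop) (hN : ∀ i s, Inv i s → s.natVar y = N)
    (h0 : Inv 0 (s.setN x 0))
    (hbody : ∀ i < N, ∀ s, Inv i s → s.natVar x = i →
      Ensures inp p s T fun s' => s'.natVar x = i ∧ Inv (i + 1) (s'.setN x (i + 1))) :
    Ensures inp (Prog.forTo x y p) s (N * (T + 8) + 6) (Inv N) := by
  have hl := Ensures.loop (inp := inp) (p := .seq p (.setNat x (.add (.var x) (.const 1))))
    (b := .natLt (.var x) (.var y)) (T := T + 4)
    (fun s => Inv (s.natVar x) s ∧ s.natVar x ≤ N) (fun s => N - s.natVar x) ?_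
    N (s.setN x 0) ⟨by simpa using h0, by simp⟩ (by simp)
  · have hl' := hl.mono (T' := N * (T + 8) + 4) (by simp only [BExp.cost, NExp.cost]; ring_nf; omega)
      (Q' := Inv N) fun s' h => by
        obtain ⟨⟨h1, h2⟩, h3⟩ := h
        have h4 := hN _ _ h1
        simp only [BExp.Holds, NExp.eval] at h3
        rwa [show s'.natVar x = N by omega] at h1
    exact (Ensures.seq (Ensures.setNat hl')).mono (by simp only [NExp.cost]; omega) fun _ => id
  · rintro s ⟨h1, h2⟩ hb
    have h4 := hN _ _ h1
    simp only [BExp.Holds, NExp.eval] at hb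
    refine Ensures.seq ((hbody _ (by omega) s h1 rfl).mono le_rfl fun s' h => ?_)
    refine Ensures.setNat ?_
    obtain ⟨h5, h6⟩ := h
    simp only [NExp.eval, h5, Store.natVar_setN, if_true]
    exact ⟨⟨h6, by omega⟩, by omega⟩

end RealRAM

/-! ### Programs for minimisation and for the path search -/

namespace RealRAM

/-- The memory contains the sizes and the offsets of the rows of the value matrix. -/
structure Ready (n m : ℕ) (s : Store) : Prop where
  size : s.natVar 0 = n
  goods : s.natVar 1 = m
  -- Layout: natural arrays `0` to `3` hold owners, ranks, parents and row offsets; real arrays `0`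
  -- and `1` hold liked counts and own values.
  row : ∀ a < n, s.natArr 3 a = 1 + n + a * m

namespace Ready

variable {n m : ℕ} {s : Store}

theorem congr (h : Ready n m s) {s' : Store} (h0 : s'.natVar 0 = s.natVar 0)
    (h1 : s'.natVar 1 = s.natVar 1) (h3 : s'.natArr 3 = s.natArr 3) : Ready n m s' :=
  ⟨h0.trans h.size, h1.trans h.goods, fun a ha => by rw [h3, h.row a ha]⟩

theorem setN (h : Ready n m s) {x : ℕ} (hx : 2 ≤ x) (v : ℕ) : Ready n m (s.setN x v) :=
  h.congr (by simp; omega) (by simp; omega) rfl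

theorem putN (h : Ready n m s) {a : ℕ} (ha : a < 3) (i v : ℕ) : Ready n m (s.putN a i v) :=
  h.congr rfl rfl (by simp; omega)

theorem putR (h : Ready n m s) (a i : ℕ) (v : ℝ) : Ready n m (s.putR a i v) :=
  h.congr rfl rfl rfl

end Ready

/-- According to the input, agent `i` has the larger value for good `e`. -/
def likes (inp : List ℝ) (n m i e : ℕ) : Prop := 1 < inp.getD (1 + n + i * m + e) 0

/-- The weight of agent `i` according to the input. -/
def weight (inp : List ℝ) (i : ℕ) : ℝ := inp.getD (1 + i) 0

section ArgBest

variable {inp : List ℝ} {n : ℕ}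

/-- The variable `t` becomes the best among the agents `x` that pass the test `ok`; it becomes the
number of agents if there is none. -/
def argBest (x t : ℕ) (ok better : BExp) : Prog :=
  .seq (.setNat t (.var 0))
    (.forTo x 0 (.ite (.and ok (.not (.and (.natLt (.var t) (.var 0)) (.not better))))
      (.setNat t (.var x)) .skip))

/-- The value `n` of variable `t` means that no candidate has been found. The test `better` is then
meaningless, which is why `hbetter` is only required when `t` holds an agent. -/
theorem argBest_spec {x t : ℕ} (hx : 0 ≠ x) (ht : 0 ≠ t) (hxt : x ≠ t) {ok better : BExp}
    {s : Store} (hn : s.natVar 0 = n) (okP : ℕ → Prop) (f : ℕ → ℝ)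
    (hok : ∀ s' : Store, s'.natArr = s.natArr → s'.realArr = s.realArr → s'.natVar x < n →
      (ok.Holds inp s' ↔ okP (s'.natVar x)))
    (hbetter : ∀ s' : Store, s'.natArr = s.natArr → s'.realArr = s.realArr → s'.natVar x < n →
      s'.natVar t < n → (better.Holds inp s' ↔ f (s'.natVar x) < f (s'.natVar t))) :
    Ensures inp (argBest x t ok better) s (n * (ok.cost + better.cost + 20) + 8) fun s' =>
      s'.natArr = s.natArr ∧ s'.realArr = s.realArr ∧
      (∀ y, y ≠ x → y ≠ t → s'.natVar y = s.natVar y) ∧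
      (s'.natVar t = n ∧ (∀ a < n, ¬ okP a) ∨
        s'.natVar t < n ∧ okP (s'.natVar t) ∧ ∀ a < n, okP a → f (s'.natVar t) ≤ f a) := by
  refine Ensures.mono (Ensures.seq (Ensures.setNat (Ensures.forTo (N := n)
    (T := ok.cost + better.cost + 12) (fun i s' =>
    s'.natArr = s.natArr ∧ s'.realArr = s.realArr ∧
      (∀ y, y ≠ x → y ≠ t → s'.natVar y = s.natVar y) ∧
      (s'.natVar t = n ∧ (∀ a < i, ¬ okP a) ∨
        s'.natVar t < n ∧ okP (s'.natVar t) ∧ ∀ a < i, okP a → f (s'.natVar t) ≤ f a))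
    ?_ ?_ fun i hi s' hs' hxi => ?_))) ?_ fun _ => id
  · rintro i s' ⟨_, _, h, _⟩
    rw [h 0 hx ht, hn]
  · refine ⟨rfl, rfl, fun y h1 h2 => by simp [h1, h2], Or.inl ⟨?_, by simp⟩⟩
    simp [hxt.symm, NExp.eval, hn]
  · obtain ⟨h1, h2, h3, h4⟩ := hs'
    have h0 : s'.natVar 0 = n := by rw [h3 0 hx ht, hn]
    have e1 := hok s' h1 h2 (by omega)
    rw [hxi] at e1
    refine (Ensures.ite_skip (T := 2) (by norm_num) (fun hb => ?_) (fun hb => ?_)).mono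
      (by simp only [BExp.cost, NExp.cost]; omega) fun _ => id
    · simp only [BExp.Holds, NExp.eval, h0] at hb
      refine (Ensures.setNat ⟨by simp [hxt, hxi], h1, h2,
        fun y hy1 hy2 => by simpa [hy1, hy2] using h3 y hy1 hy2, Or.inr ?_⟩).mono
        (by simp [NExp.cost]) fun _ => id
      simp only [Store.natVar_setN, if_neg hxt.symm, if_true, NExp.eval, hxi]
      refine ⟨hi, e1.1 hb.1, fun a ha hoka => ?_⟩
      rcases Nat.lt_succ_iff_lt_or_eq.1 ha with ha | rfl
      · rcases h4 with ⟨_, h5⟩ | ⟨h5, h6, h7⟩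
        · exact absurd hoka (h5 a ha)
        · have e2 := hbetter s' h1 h2 (by omega) h5
          rw [hxi] at e2
          have : f i < f (s'.natVar t) := e2.1 (by
            by_contra hc
            exact hb.2 ⟨h5, hc⟩)
          exact this.le.trans (h7 a ha hoka)
      · exact le_rfl
    · simp only [BExp.Holds, NExp.eval, h0] at hb
      refine ⟨hxi, h1, h2, fun y hy1 hy2 => by simpa [hy1, hy2] using h3 y hy1 hy2, ?_⟩
      simp only [Store.natVar_setN, if_neg hxt.symm]
      rcases h4 with ⟨h5, h6⟩ | ⟨h5, h6, h7⟩
      · refine Or.inl ⟨h5, fun a ha => ?_⟩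
        rcases Nat.lt_succ_iff_lt_or_eq.1 ha with ha | rfl
        · exact h6 a ha
        · intro hoka
          exact hb ⟨e1.2 hoka, fun hh => by omega⟩
      · refine Or.inr ⟨h5, h6, fun a ha hoka => ?_⟩
        rcases Nat.lt_succ_iff_lt_or_eq.1 ha with ha | rfl
        · exact h7 a ha hoka
        · have e2 := hbetter s' h1 h2 (by omega) h5
          rw [hxi] at e2
          by_contra hlt
          exact hb ⟨e1.2 hoka, fun hh => hh.2 (e2.2 (not_le.1 hlt))⟩
  · simp only [NExp.cost]
    ring_nf
    omega

end ArgBest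

section Search

variable {inp : List ℝ} {n m : ℕ}

/-- The parts of the memory that a search does not change. -/
structure Keeps (n m : ℕ) (X : ℕ → ℕ) (ρ : ℕ → ℕ → ℝ) (e : ℕ) (s : Store) : Prop where
  ready : Ready n m s
  owner : s.natArr 0 = X
  reals : s.realArr = ρ
  good : s.natVar 2 = e

namespace Keeps

variable {X : ℕ → ℕ} {ρ : ℕ → ℕ → ℝ} {e : ℕ} {s : Store}

theorem setN (h : Keeps n m X ρ e s) {x : ℕ} (hx : 3 ≤ x) (v : ℕ) :
    Keeps n m X ρ e (s.setN x v) :=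
  ⟨h.ready.setN (by omega) v, h.owner, h.reals, by simpa [show 2 ≠ x by omega] using h.good⟩

theorem putN (h : Keeps n m X ρ e s) {a : ℕ} (ha : a < 3) (ha' : a ≠ 0) (i v : ℕ) :
    Keeps n m X ρ e (s.putN a i v) :=
  ⟨h.ready.putN ha i v, by simpa [ha'.symm] using h.owner, h.reals, h.good⟩

end Keeps

/-- Agent `5` likes good `4`. -/
def likesTest : BExp := .realLt (.const 1) (.input (.add (.get 3 (.var 5)) (.var 4)))

theorem likesTest_holds {s : Store} (h : Ready n m s) (ha : s.natVar 5 < n) :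
    likesTest.Holds inp s ↔ likes inp n m (s.natVar 5) (s.natVar 4) := by
  simp only [likesTest, BExp.Holds, RExp.eval, NExp.eval, h.row _ ha, likes, Nat.cast_one]

/-- One step of the search: agent `5` is labelled if she likes good `4` and its owner is
labelled. -/
def labelStep : Prog :=
  .ite (.and likesTest (.and (.natLt (.get 1 (.var 5)) (.const 1))
      (.natLt (.const 0) (.get 1 (.get 0 (.var 4))))))
    (.seq (.putNat 2 (.var 5) (.var 4))
      (.putNat 1 (.var 5) (.add (.get 1 (.get 0 (.var 4))) (.const 1)))) .skip

/-- The search for alternating paths that end at the position `n`. -/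
def search : Prog :=
  .seq (.forTo 5 0 (.putNat 1 (.var 5) (.const 0)))
    (.seq (.putNat 1 (.var 0) (.const 1))
      (.forTo 3 0 (.forTo 4 1 (.forTo 5 0 labelStep))))

/-- Each scan either finds the labels closed or labels a new agent, so `n` scans are enough. The
reset leaves the cells beyond `n` alone; `hbeyond` keeps goods not yet inserted out of the search.
-/
theorem search_spec {X : ℕ → ℕ} {ρ : ℕ → ℕ → ℝ} {e : ℕ} {s : Store}
    (hs : Keeps n m X ρ e s) (hbeyond : ∀ x, n < x → s.natArr 1 x = 0) :
    Ensures inp search s (n * (m * (n * 38 + 14) + 14) + n * 11 + 15) fun s' =>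
      Keeps n m X ρ e s' ∧ SearchForest n m (likes inp n m) X (s'.natArr 1) (s'.natArr 2) ∧
      SearchClosed n m (likes inp n m) X (s'.natArr 1) := by
  have hreset := Ensures.forTo (inp := inp) (p := .putNat 1 (.var 5) (.const 0)) (s := s)
    (x := 5) (y := 0) (N := n) (T := 3)
    (fun a s' => Keeps n m X ρ e s' ∧ (∀ x < a, s'.natArr 1 x = 0) ∧
      ∀ x, n < x → s'.natArr 1 x = 0) (fun _ _ h => h.1.ready.size)
    ⟨hs.setN (by norm_num) _, by simp, hbeyond⟩ (by
      rintro a ha s' ⟨h1, h2, h3⟩ hx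
      refine Ensures.putNat ?_
      simp only [NExp.eval, hx]
      refine ⟨by simpa using hx, (h1.putN (by norm_num) (by norm_num) _ _).setN (by norm_num) _,
        fun x hxa => ?_, fun x hxn => ?_⟩
      · simp only [Store.natArr_setN, Store.natArr_putN, if_true, Function.update_apply]
        split_ifs
        · rfl
        · exact h2 x (by omega)
      · simp only [Store.natArr_setN, Store.natArr_putN, if_true, Function.update_apply]
        split_ifs
        · rfl
        · exact h3 x hxn)
  have hrounds : ∀ s', Keeps n m X ρ e s' →
      SearchForest n m (likes inp n m) X (s'.natArr 1) (s'.natArr 2) →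
      Ensures inp (.forTo 3 0 (.forTo 4 1 (.forTo 5 0 labelStep))) s'
        (n * (m * (n * 38 + 14) + 14) + 6) fun s' =>
      Keeps n m X ρ e s' ∧ SearchForest n m (likes inp n m) X (s'.natArr 1) (s'.natArr 2) ∧
      SearchProgress n m (likes inp n m) X (s'.natArr 1) n := by
    intro s' h1 h2
    refine (Ensures.forTo (N := n) (T := m * (n * 38 + 14) + 6) (fun r s' => Keeps n m X ρ e s' ∧
      SearchForest n m (likes inp n m) X (s'.natArr 1) (s'.natArr 2) ∧
      SearchProgress n m (likes inp n m) X (s'.natArr 1) r) (fun _ _ h => h.1.ready.size)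
      ⟨h1.setN (by norm_num) _, h2, Or.inr (Nat.zero_le _)⟩ ?_).mono (by ring_nf; omega)
      fun _ => id
    rintro r - s₀ ⟨h1, h2, h3⟩ hr
    refine (Ensures.forTo (N := m) (T := n * 38 + 6) (fun g s' => Keeps n m X ρ e s' ∧
      s'.natVar 3 = r ∧ ScanState n m (likes inp n m) X (s₀.natArr 1) g 0 (s'.natArr 1)
        (s'.natArr 2)) (fun _ _ h => h.1.ready.goods)
      ⟨h1.setN (by norm_num) _, by simpa using hr, .init h2⟩ ?_).mono (by ring_nf; omega) ?_
    · rintro g hg s₁ ⟨h1, h2, h3⟩ hgs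
      refine (Ensures.forTo (N := n) (T := 30) (fun a s' => Keeps n m X ρ e s' ∧
        s'.natVar 3 = r ∧ s'.natVar 4 = g ∧
        ScanState n m (likes inp n m) X (s₀.natArr 1) g a (s'.natArr 1)
          (s'.natArr 2)) (fun _ _ h => h.1.ready.size)
        ⟨h1.setN (by norm_num) _, by simpa using h2, by simpa using hgs, h3⟩ ?_).mono
        (by ring_nf; omega) ?_
      · rintro a ha s₂ ⟨h1, h2, h3, h4⟩ has
        have hlike := likesTest_holds (inp := inp) h1.ready (by omega)
        rw [has, h3] at hlike
        refine Ensures.mono (Ensures.ite_skip (T := 10) (by norm_num) (fun hb => ?_)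
          (fun hb => ?_)) (by simp [BExp.cost, NExp.cost, RExp.cost, likesTest]) fun _ => id
        · simp only [BExp.Holds, hlike, NExp.eval, has, h3, h1.owner, Nat.lt_one_iff] at hb
          refine Ensures.mono (Ensures.seq (Ensures.putNat (Ensures.putNat ?_))) (T' := 10)
            (by simp [NExp.cost]) fun _ => id
          refine ⟨by simpa using has, ((h1.putN (by norm_num) (by norm_num) _ _).putN
            (by norm_num) (by norm_num) _ _).setN (by norm_num) _, by simpa using h2,
            by simpa using h3, ?_⟩
          simpa [NExp.eval, has, h3, h1.owner] using h4.step hg ha hb.1 hb.2.1 hb.2.2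
        · simp only [BExp.Holds, hlike, NExp.eval, has, h3, h1.owner, Nat.lt_one_iff] at hb
          exact ⟨has, h1.setN (by norm_num) _, by simpa using h2, by simpa using h3, h4.skip hb⟩
      · rintro s₂ ⟨h1, h2, h3, h4⟩
        exact ⟨h3, h1.setN (by norm_num) _, by simpa using h2, h4.nextGood⟩
    · rintro s₁ ⟨h4, h5, h6⟩
      exact ⟨h5, h4.setN (by norm_num) _, h6.forest, h3.next h6⟩
  refine Ensures.mono (Ensures.seq (hreset.mono le_rfl ?_))
    (T' := n * (m * (n * 38 + 14) + 14) + n * 11 + 15)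
    (T := (n * (3 + 8) + 6) + (3 + (n * (m * (n * 38 + 14) + 14) + 6))) (by ring_nf; omega)
    fun _ => id
  rintro s' ⟨h1, h2, h3⟩
  refine Ensures.seq (Ensures.putNat ((hrounds _ (h1.putN (by norm_num) (by norm_num) _ _)
    ?_).mono le_rfl fun s'' h => ⟨h.1, h.2.1, h.2.2.closed⟩))
  simp only [NExp.eval, h1.ready.size, Store.natArr_putN, if_true]
  refine ⟨by simp, fun x hx => ?_, fun a ha hpos => ?_⟩
  · rw [Function.update_of_ne (by omega)]; exact h3 x hx
  · rw [Function.update_of_ne (by omega), h2 a ha] at hpos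
    omega

end Search

end RealRAM

/-! ### Programs for inserting and giving goods -/

namespace RealRAM

variable {inp : List ℝ} {n m : ℕ}

/-- The weighted entry `x` of the real array `a` is smaller than the weighted entry `t`. -/
def lessTest (a x t : ℕ) : BExp :=
  .realLt (.mulInput (.get a (.var x)) (.add (.const 1) (.var t)))
    (.mulInput (.get a (.var t)) (.add (.const 1) (.var x)))

/-- The machine cannot divide, and multiplies only by input numbers; weights are input numbers, so
quotients are compared after cross-multiplication. -/
theorem lessTest_holds (hw : ∀ i < n, 0 < weight inp i) {a x t : ℕ} {s : Store}
    (hx : s.natVar x < n) (ht : s.natVar t < n) :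
    (lessTest a x t).Holds inp s ↔
      s.realArr a (s.natVar x) / weight inp (s.natVar x) <
        s.realArr a (s.natVar t) / weight inp (s.natVar t) := by
  rw [div_lt_div_iff₀ (hw _ hx) (hw _ ht)]
  rfl

section Insertion

/-- Agent `5` takes the good that is her label, and its former owner is next, until the position
`n` is reached. -/
def augment : Prog :=
  .loop (.natLt (.var 5) (.var 0))
    (.seq (.setNat 4 (.get 2 (.var 5)))
      (.seq (.setNat 8 (.get 0 (.var 4)))
        (.seq (.putNat 0 (.var 4) (.var 5)) (.setNat 5 (.var 8)))))

/-- The rank of the agent who is owed a good falls in each round and is at most `n + 1`, which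
bounds the number of rounds. -/
theorem augment_spec {X rank par : ℕ → ℕ} {ρ : ℕ → ℕ → ℝ} {e t : ℕ} {s : Store}
    (hf : SearchForest n m (likes inp n m) X rank par)
    (hliked : ∀ g < m, X g < n → likes inp n m (X g) g)
    (hsource : ∀ g < m, X g = n → g ≠ e → ∀ i < n, ¬ likes inp n m i g)
    (hs : Ready n m s) (hrank : s.natArr 1 = rank) (hpar : s.natArr 2 = par)
    (hρ : s.realArr = ρ) (he : s.natVar 2 = e)
    (h : AugmentState n m (likes inp n m) X rank e t (s.natArr 0) (s.natVar 5)) :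
    Ensures inp augment s ((n + 1) * 15 + 4) fun s' =>
      Ready n m s' ∧ s'.natArr 1 = rank ∧ s'.realArr = ρ ∧ s'.natVar 2 = e ∧
      AugmentState n m (likes inp n m) X rank e t (s'.natArr 0) n := by
  refine (Ensures.loop (T := 11) (fun s' => Ready n m s' ∧ s'.natArr 1 = rank ∧
    s'.natArr 2 = par ∧ s'.realArr = ρ ∧ s'.natVar 2 = e ∧
    AugmentState n m (likes inp n m) X rank e t (s'.natArr 0) (s'.natVar 5))
    (fun s' => rank (s'.natVar 5)) ?_ (n + 1) s ⟨hs, hrank, hpar, hρ, he, h⟩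
    (hf.rank_le h.le)).mono (by simp [BExp.cost, NExp.cost]) ?_
  · rintro s' ⟨h1, h2, h3, h4, h5, h6⟩ hb
    simp only [BExp.Holds, NExp.eval, h1.size] at hb
    obtain ⟨h7, h8⟩ := h6.step hf hliked hsource hb
    refine Ensures.mono (Ensures.seq (Ensures.setNat (Ensures.seq (Ensures.setNat
      (Ensures.seq (Ensures.putNat (Ensures.setNat ?_))))))) (by simp [NExp.cost]) fun _ => id
    refine ⟨⟨(((h1.setN (by norm_num) _).setN (by norm_num) _).putN (by norm_num) _ _).setN
      (by norm_num) _, by simpa using h2, by simpa using h3, h4, by simpa using h5, ?_⟩, ?_⟩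
    · simpa [NExp.eval, h3] using h7
    · simpa [NExp.eval, h3] using h8
  · rintro s' ⟨⟨h1, h2, _, h4, h5, h6⟩, hb⟩
    simp only [BExp.Holds, NExp.eval, h1.size] at hb
    have := h6.le
    exact ⟨h1, h2, h4, h5, (show s'.natVar 5 = n by omega) ▸ h6⟩

/-- The memory between two insertions of liked goods. -/
structure InsertionState (inp : List ℝ) (n m e : ℕ) (s : Store) : Prop where
  ready : Ready n m s
  partial_alloc : LikedPartial n m (likes inp n m) (weight inp) e (s.natArr 0)
  beyond : ∀ x, n < x → s.natArr 1 x = 0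
  counts : ∀ a < n, s.realArr 0 a = likedCount m (likes inp n m) (s.natArr 0) a

/-- Insertion of good `2`, along an alternating path to an agent of least load. -/
def insertGood : Prog :=
  .seq (.putNat 0 (.var 2) (.var 0))
    (.seq search
      (.seq (argBest 5 6 (.natLt (.const 0) (.get 1 (.var 5))) (lessTest 0 5 6))
        (.seq (.putReal 0 (.var 6) (.add (.get 0 (.var 6)) (.const 1)))
          (.seq (.setNat 5 (.var 6)) augment))))

theorem insertGood_spec (hw : ∀ i < n, 0 < weight inp i) {e : ℕ} (hem : e < m) {s : Store}
    (hs : InsertionState inp n m e s) (he : s.natVar 2 = e) :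
    Ensures inp insertGood s (n * (m * (n * 38 + 14) + 14) + n * 100 + 100) fun s' =>
      s'.natVar 2 = e ∧ InsertionState inp n m (e + 1) s' := by
  set X := s.natArr 0 with hX
  obtain ⟨hbal, hliked, hsource⟩ := hs.partial_alloc.place
  set X₁ := Function.update X e n with hX₁
  have hcnt₁ : ∀ a < n, likedCount m (likes inp n m) X₁ a = likedCount m (likes inp n m) X a := by
    intro a ha
    refine likedCount_congr fun g hg => ?_
    by_cases hge : g = e
    · subst hge
      have : X g = n + 1 := hs.partial_alloc.rest g le_rfl hg
      rw [hX₁, Function.update_self]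
      omega
    · rw [hX₁, Function.update_of_ne hge]
  have hstart : Keeps n m X₁ s.realArr e (s.putN 0 e n) :=
    ⟨hs.ready.putN (by norm_num) _ _, by simp [hX₁, hX], rfl, he⟩
  refine Ensures.mono (Ensures.seq (Ensures.putNat (Ensures.seq ((search_spec
    (X := X₁) (ρ := s.realArr) (e := e) ?_ ?_).mono le_rfl ?_)))) (T := 3 +
    ((n * (m * (n * 38 + 14) + 14) + n * 11 + 15) + ((n * (4 + 13 + 20) + 8) +
      (6 + (2 + ((n + 1) * 15 + 4)))))) (by ring_nf; omega) fun _ => id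
  · simpa only [NExp.eval, he, hs.ready.size] using hstart
  · exact hs.beyond
  rintro s₁ ⟨h1, hf, hc⟩
  refine Ensures.seq ((argBest_spec (by norm_num) (by norm_num) (by norm_num) h1.ready.size
    (fun a => 0 < s₁.natArr 1 a) (fun a => s₁.realArr 0 a / weight inp a) ?_ ?_).mono
    le_rfl ?_)
  · intro s' ha _ _
    simp [BExp.Holds, NExp.eval, ha]
  · intro s' _ hr hx ht
    rw [lessTest_holds hw hx ht, hr]
  rintro s₂ ⟨ha₂, hr₂, hv₂, hbest⟩
  have hready₂ : Ready n m s₂ := h1.ready.congr (hv₂ 0 (by norm_num) (by norm_num))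
    (hv₂ 1 (by norm_num) (by norm_num)) (by rw [ha₂])
  have he₂ : s₂.natVar 2 = e := (hv₂ 2 (by norm_num) (by norm_num)).trans h1.good
  refine Ensures.seq (Ensures.putReal (Ensures.seq (Ensures.setNat ?_)))
  simp only [NExp.eval, RExp.eval, Store.natVar_putR]
  have hreal : ∀ a < n, s₂.realArr 0 a = likedCount m (likes inp n m) X₁ a := by
    intro a ha
    rw [hr₂, h1.reals, hs.counts a ha, hcnt₁ a ha]
  -- If nobody is labelled, `t = n`: the increment hits a cell that belongs to no agent, and the
  -- augmenting loop stops at once.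
  rcases hbest with ⟨ht, hnone⟩ | ⟨ht, htr, hmin⟩
  · have hnone' : ∀ a < n, s₁.natArr 1 a = 0 := fun a ha => by
      have := hnone a ha
      omega
    refine ⟨_, _, .loopFalse ?_, ?_, ?_, ?_, ?_, ?_, ?_⟩
    · simp [BExp.Holds, NExp.eval, ht, hready₂.size]
    · simp [BExp.cost, NExp.cost]
    · simpa using he₂
    · exact (hready₂.putR _ _ _).setN (by norm_num) _
    · simpa [ha₂, h1.owner] using hs.partial_alloc.next_of_closed hem hf hc hnone'
    · simpa [ha₂] using hf.rank_beyond
    · intro a ha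
      simp only [Store.realArr_setN, Store.realArr_putR, if_true, Store.natArr_setN,
        Store.natArr_putR, ha₂, h1.owner]
      rw [Function.update_of_ne (by omega), hreal a ha]
  · set t := s₂.natVar 6 with htdef
    refine (augment_spec (X := X₁) (e := e) (t := t) hf hliked hsource
      ((hready₂.putR _ _ _).setN (by norm_num) _) (by simp [ha₂]) (by simp [ha₂]) rfl
      (by simpa using he₂) ?_).mono le_rfl ?_
    · simpa [ha₂, h1.owner] using AugmentState.init ht htr
    rintro s₃ ⟨h4, h5, h6, h7, h8⟩
    refine ⟨h7, h4, hs.partial_alloc.next_of_augment hw hf hc ht htr ?_ h8, ?_, ?_⟩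
    · intro i hi hri
      have := hmin i hi hri
      rwa [← hr₂, hreal i hi, hreal t ht] at this
    · rw [h5]; exact hf.rank_beyond
    · intro a ha
      have h9 := h8.count a ha
      rw [if_neg (by omega : ¬ a = n), add_zero] at h9
      rw [h6, h9]
      simp only [Store.realArr_setN, Store.realArr_putR, if_true, Nat.cast_one]
      by_cases hat : a = t
      · rw [if_pos hat, hat, Function.update_self, hreal t ht]
      · rw [if_neg hat, Function.update_of_ne hat, hreal a ha, add_zero]

end Insertion

section Giving

/-- The real arrays contain the loads of all agents. -/
structure LoadsState (inp : List ℝ) (n m : ℕ) (s : Store) : Prop where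
  ready : Ready n m s
  counts : ∀ a < n, s.realArr 0 a = likedCount m (likes inp n m) (s.natArr 0) a
  values : ∀ a < n, s.realArr 1 a =
    ownValue m (likes inp n m) (inp.getD 0 0) (s.natArr 0) a

theorem LoadsState.congr {s s' : Store} (h : LoadsState inp n m s) (h0 : s'.natVar 0 = s.natVar 0)
    (h1 : s'.natVar 1 = s.natVar 1) (ha : s'.natArr = s.natArr) (hr : s'.realArr = s.realArr) :
    LoadsState inp n m s' :=
  ⟨h.ready.congr h0 h1 (by rw [ha]), by rw [ha, hr]; exact h.counts,
    by rw [ha, hr]; exact h.values⟩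

/-- A test that always succeeds. -/
def always : BExp := .natLt (.const 0) (.const 1)

theorem always_holds (s : Store) : always.Holds inp s := Nat.zero_lt_one

/-- The variable `6` becomes an agent of least weighted value. -/
def poorest : Prog := argBest 5 6 always (lessTest 1 5 6)

theorem poorest_spec (hw : ∀ i < n, 0 < weight inp i) (hn : 0 < n) {s : Store}
    (hs : LoadsState inp n m s) :
    Ensures inp poorest s (n * 36 + 8) fun s' =>
      s'.natArr = s.natArr ∧ s'.realArr = s.realArr ∧
      (∀ y, y ≠ 5 → y ≠ 6 → s'.natVar y = s.natVar y) ∧ s'.natVar 6 < n ∧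
      ∀ i < n, ownValue m (likes inp n m) (inp.getD 0 0) (s.natArr 0) (s'.natVar 6) /
          weight inp (s'.natVar 6) ≤
        ownValue m (likes inp n m) (inp.getD 0 0) (s.natArr 0) i / weight inp i := by
  refine (argBest_spec (by norm_num) (by norm_num) (by norm_num) hs.ready.size
    (fun _ => True) (fun a => s.realArr 1 a / weight inp a) ?_ ?_).mono
    (by simp [always, lessTest, BExp.cost, NExp.cost, RExp.cost]) ?_
  · intro s' _ _ _
    exact iff_of_true (always_holds s') trivial
  · intro s' _ hr hx ht
    rw [lessTest_holds hw hx ht, hr]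
  · rintro s' ⟨h1, h2, h3, h4⟩
    rcases h4 with ⟨_, h4⟩ | ⟨h4, _, h5⟩
    · exact absurd trivial (h4 0 hn)
    · refine ⟨h1, h2, h3, h4, fun i hi => ?_⟩
      have := h5 i hi trivial
      rwa [hs.values _ h4, hs.values i hi] at this

/-- If good `2` has no owner yet, it is given to a poorest agent. -/
def giveGood : Prog :=
  .ite (.natLt (.get 0 (.var 2)) (.var 0)) .skip
    (.seq poorest
      (.seq (.putNat 0 (.var 2) (.var 6))
        (.putReal 1 (.var 6) (.add (.get 1 (.var 6)) (.const 1)))))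

theorem giveGood_spec (hw : ∀ i < n, 0 < weight inp i) (hn : 0 < n) {e : ℕ} (hem : e < m)
    {s : Store} (hs : LoadsState inp n m s)
    (hX : FairPartial n m (likes inp n m) (inp.getD 0 0) (weight inp) e (s.natArr 0))
    (he : s.natVar 2 = e) :
    Ensures inp giveGood s (n * 36 + 25) fun s' =>
      s'.natVar 2 = e ∧ LoadsState inp n m s' ∧
      FairPartial n m (likes inp n m) (inp.getD 0 0) (weight inp) (e + 1) (s'.natArr 0) := by
  refine (Ensures.ite (T := (n * 36 + 8) + (3 + 6)) (fun hb => ?_) (fun hb => ?_)).mono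
    (by simp only [BExp.cost, NExp.cost]; omega) fun _ => id
  · simp only [BExp.Holds, NExp.eval, he, hs.ready.size] at hb
    exact (Ensures.skip ⟨he, hs, hX.skip hb⟩).mono (by omega) fun _ => id
  · simp only [BExp.Holds, NExp.eval, he, hs.ready.size] at hb
    refine Ensures.seq ((poorest_spec hw hn hs).mono le_rfl ?_)
    rintro s₁ ⟨h1, h2, h3, h4, h5⟩
    have hs₁ : LoadsState inp n m s₁ := hs.congr (h3 0 (by norm_num) (by norm_num))
      (h3 1 (by norm_num) (by norm_num)) h1 h2
    have he₁ : s₁.natVar 2 = e := (h3 2 (by norm_num) (by norm_num)).trans he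
    obtain ⟨h6, h7, h8⟩ := hX.give hw hem (not_lt.1 hb) h4 h5
    refine Ensures.seq (Ensures.putNat (Ensures.putReal ?_))
    simp only [NExp.eval, RExp.eval, he₁, Store.natVar_putN, Store.realArr_putN, Nat.cast_one]
    set t := s₁.natVar 6 with htdef
    refine ⟨by simpa using he₁, ⟨(hs₁.ready.putN (by norm_num) _ _).putR _ _ _, ?_, ?_⟩, ?_⟩
    · intro a ha
      simpa [h1, h7 a ha, h2] using hs.counts a ha
    · intro a ha
      simp only [Store.realArr_putR, Store.realArr_putN, if_true, Store.natArr_putR,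
        Store.natArr_putN, h1, h8 a ha]
      by_cases hat : a = t
      · rw [hat, Function.update_self, if_pos rfl, h2, hs.values t h4]
      · rw [Function.update_of_ne hat, if_neg hat, add_zero, h2, hs.values a ha]
    · simpa [h1] using h6

end Giving

end RealRAM

/-! ### Program for the redistribution -/

namespace RealRAM

variable {inp : List ℝ} {n m : ℕ}

section Redistribution

/-- The variable `7` becomes an agent with the largest load of liked goods, up to one good. -/
def richest : Prog :=
  argBest 5 7 always
    (.realLt (.mulInput (.sub (.get 0 (.var 7)) (.const 1)) (.add (.const 1) (.var 5)))
      (.mulInput (.sub (.get 0 (.var 5)) (.const 1)) (.add (.const 1) (.var 7))))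

theorem richest_spec (hw : ∀ i < n, 0 < weight inp i) (hn : 0 < n) {s : Store}
    (hs : LoadsState inp n m s) :
    Ensures inp richest s (n * 40 + 8) fun s' =>
      s'.natArr = s.natArr ∧ s'.realArr = s.realArr ∧
      (∀ y, y ≠ 5 → y ≠ 7 → s'.natVar y = s.natVar y) ∧ s'.natVar 7 < n ∧
      ∀ i < n, (likedCount m (likes inp n m) (s.natArr 0) i - 1) / weight inp i ≤
        (likedCount m (likes inp n m) (s.natArr 0) (s'.natVar 7) - 1) /
          weight inp (s'.natVar 7) := by
  -- The maximum is obtained as the minimum of the negated load.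
  refine (argBest_spec (by norm_num) (by norm_num) (by norm_num) hs.ready.size
    (fun _ => True) (fun a => -((s.realArr 0 a - 1) / weight inp a)) ?_ ?_).mono
    (by simp [always, BExp.cost, NExp.cost, RExp.cost]) ?_
  · intro s' _ _ _
    exact iff_of_true (always_holds s') trivial
  · intro s' _ hr hx ht
    rw [neg_lt_neg_iff, div_lt_div_iff₀ (hw _ ht) (hw _ hx), ← hr]
    simp only [BExp.Holds, RExp.eval, NExp.eval, Nat.cast_one]
    rfl
  · rintro s' ⟨h1, h2, h3, h4⟩
    rcases h4 with ⟨_, h4⟩ | ⟨h4, _, h5⟩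
    · exact absurd trivial (h4 0 hn)
    · refine ⟨h1, h2, h3, h4, fun i hi => ?_⟩
      have := neg_le_neg_iff.1 (h5 i hi trivial)
      rwa [hs.counts _ h4, hs.counts i hi] at this

/-- The variable `9` becomes a good of agent `7`. -/
def pickGood : Prog :=
  .forTo 4 1 (.ite (.and (.not (.natLt (.get 0 (.var 4)) (.var 7)))
    (.not (.natLt (.var 7) (.get 0 (.var 4))))) (.setNat 9 (.var 4)) .skip)

theorem pickGood_spec {s : Store} (hs : Ready n m s)
    (hex : ∃ g < m, s.natArr 0 g = s.natVar 7) :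
    Ensures inp pickGood s (m * 25 + 6) fun s' =>
      s'.natArr = s.natArr ∧ s'.realArr = s.realArr ∧
      (∀ y, y ≠ 4 → y ≠ 9 → s'.natVar y = s.natVar y) ∧ s'.natVar 9 < m ∧
      s.natArr 0 (s'.natVar 9) = s.natVar 7 := by
  refine (Ensures.forTo (N := m) (T := 17) (fun i s' =>
      s'.natArr = s.natArr ∧ s'.realArr = s.realArr ∧
      (∀ y, y ≠ 4 → y ≠ 9 → s'.natVar y = s.natVar y) ∧
      ((∃ g < i, s.natArr 0 g = s.natVar 7) →
        s'.natVar 9 < m ∧ s.natArr 0 (s'.natVar 9) = s.natVar 7)) ?_ ?_ ?_).mono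
    (by ring_nf; omega) ?_
  · rintro i s' ⟨_, _, h, _⟩
    rw [h 1 (by norm_num) (by norm_num), hs.goods]
  · exact ⟨rfl, rfl, fun y h1 h2 => by simp [h1], by simp⟩
  · rintro i hi s' ⟨h1, h2, h3, h4⟩ hx
    have h7 := h3 7 (by norm_num) (by norm_num)
    refine Ensures.mono (Ensures.ite_skip (T := 2) (by norm_num) (fun hb => ?_) (fun hb => ?_))
      (by simp [BExp.cost, NExp.cost]) fun _ => id
    · simp only [BExp.Holds, NExp.eval, hx, h1, h7] at hb
      refine Ensures.setNat ⟨by simpa using hx, h1, h2,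
        fun y hy1 hy2 => by simpa [hy1, hy2] using h3 y hy1 hy2, fun _ => ?_⟩
      simp only [NExp.eval, hx, Store.natVar_setN]
      exact ⟨by simpa using hi, by simpa using (by omega : s.natArr 0 i = s.natVar 7)⟩
    · simp only [BExp.Holds, NExp.eval, hx, h1, h7] at hb
      refine ⟨hx, h1, h2, fun y hy1 hy2 => by simpa [hy1, hy2] using h3 y hy1 hy2, ?_⟩
      rintro ⟨g, hg, hgX⟩
      have hgi : g ≠ i := by
        rintro rfl
        omega
      simpa using h4 ⟨g, by omega, hgX⟩
  · rintro s' ⟨h1, h2, h3, h4⟩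
    exact ⟨h1, h2, h3, h4 hex⟩

/-- No agent has too large a load of liked goods. -/
def Settled (inp : List ℝ) (n m : ℕ) (X : ℕ → ℕ) : Prop :=
  ∀ i < n, ∀ j < n, (likedCount m (likes inp n m) X j - 1) / weight inp j ≤
    ownValue m (likes inp n m) (inp.getD 0 0) X i / weight inp i

open Classical in
/-- The number of goods whose owners do not like them. -/
noncomputable def unlikedTotal (m : ℕ) (L : ℕ → ℕ → Prop) (X : ℕ → ℕ) : ℕ :=
  ((Finset.range m).filter fun e => ¬ L (X e) e).card

/-- Progress measure: `g` joins the goods not liked by their owners, and no other good changes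
hands. -/
theorem unlikedTotal_move {L : ℕ → ℕ → Prop} {X : ℕ → ℕ} {g t : ℕ} (hg : g < m)
    (h : L (X g) g) (h' : ¬ L t g) :
    unlikedTotal m L X + 1 ≤ unlikedTotal m L (Function.update X g t) := by
  classical
  refine Nat.succ_le_of_lt (Finset.card_lt_card ?_)
  refine (Finset.ssubset_iff_of_subset ?_).2 ⟨g, ?_, ?_⟩
  · intro e he
    simp only [Finset.mem_filter] at he ⊢
    have : e ≠ g := by
      rintro rfl
      exact he.2 h
    rwa [Function.update_of_ne this]
  · simpa using ⟨hg, h'⟩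
  · simp [h]

/-- When the measure reaches `m`, no owner likes any of her goods; all liked counts vanish and the
left sides become negative. -/
theorem settled_of_unlikedTotal (hk : 1 < inp.getD 0 0) (hw : ∀ i < n, 0 < weight inp i)
    {X : ℕ → ℕ} (h : m ≤ unlikedTotal m (likes inp n m) X) : Settled inp n m X := by
  classical
  have hall : ∀ e < m, ¬ likes inp n m (X e) e := by
    have h1 : (Finset.range m).filter (fun e => ¬ likes inp n m (X e) e) = Finset.range m :=
      Finset.eq_of_subset_of_card_le (Finset.filter_subset _ _) (by simpa [unlikedTotal] using h)
    intro e he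
    have h2 := Finset.mem_range.2 he
    rw [← h1] at h2
    exact (Finset.mem_filter.1 h2).2
  intro i hi j hj
  have h0 : likedCount m (likes inp n m) X j = 0 := by
    by_contra hne
    obtain ⟨e, he, rfl, hL⟩ := exists_of_likedCount_pos
      (lt_of_le_of_ne (likedCount_nonneg j) (Ne.symm hne))
    exact hall e he hL
  rw [h0]
  have h1 := hw i hi
  have h2 := hw j hj
  have h3 := ownValue_nonneg (m := m) (L := likes inp n m) (X := X) hk i
  calc (0 - 1) / weight inp j ≤ 0 := div_nonpos_of_nonpos_of_nonneg (by norm_num) h2.le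
    _ ≤ _ := by positivity

/-- One round of the redistribution. -/
def redistribute : Prog :=
  .seq poorest (.seq richest
    (.ite (.realLt (.mulInput (.get 1 (.var 6)) (.add (.const 1) (.var 7)))
        (.mulInput (.sub (.get 0 (.var 7)) (.const 1)) (.add (.const 1) (.var 6))))
      (.seq pickGood
        (.seq (.putNat 0 (.var 9) (.var 6))
          (.seq (.putReal 0 (.var 7) (.sub (.get 0 (.var 7)) (.const 1)))
            (.seq (.putReal 1 (.var 7) (.sub (.get 1 (.var 7)) (.input (.const 0))))
              (.putReal 1 (.var 6) (.add (.get 1 (.var 6)) (.const 1)))))))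
      .skip))

/-- Comparing the poorest agent with the richest decides `Settled` for all pairs. If the test fails,
the allocation is settled and remains unchanged; if it succeeds, the allocation was not settled and
the move raises `unlikedTotal`. -/
theorem redistribute_spec (hk : 1 < inp.getD 0 0) (hw : ∀ i < n, 0 < weight inp i) (hn : 0 < n)
    {r : ℕ} {s : Store} (hs : LoadsState inp n m s)
    (hX : ∃ U, PricedInvariant n m (likes inp n m) (inp.getD 0 0) (weight inp) U (s.natArr 0))
    (hp : Settled inp n m (s.natArr 0) ∨ r ≤ unlikedTotal m (likes inp n m) (s.natArr 0))
    (hr : s.natVar 2 = r) :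
    Ensures inp redistribute s (n * 76 + m * 25 + 70) fun s' =>
      s'.natVar 2 = r ∧ LoadsState inp n m s' ∧
      (∃ U, PricedInvariant n m (likes inp n m) (inp.getD 0 0) (weight inp) U (s'.natArr 0)) ∧
      (Settled inp n m (s'.natArr 0) ∨
        r + 1 ≤ unlikedTotal m (likes inp n m) (s'.natArr 0)) := by
  refine Ensures.mono (Ensures.seq ((poorest_spec hw hn hs).mono le_rfl ?_))
    (T := (n * 36 + 8) + ((n * 40 + 8) + (16 + ((m * 25 + 6) + (3 + (6 + (7 + 6)))))))
    (by ring_nf; omega) fun _ => id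
  rintro s₁ ⟨h1, h2, h3, h4, h5⟩
  have hs₁ : LoadsState inp n m s₁ := hs.congr (h3 0 (by norm_num) (by norm_num))
    (h3 1 (by norm_num) (by norm_num)) h1 h2
  refine Ensures.seq ((richest_spec hw hn hs₁).mono le_rfl ?_)
  rintro s₂ ⟨h1', h2', h3', h4', h5'⟩
  have hs₂ : LoadsState inp n m s₂ := hs₁.congr (h3' 0 (by norm_num) (by norm_num))
    (h3' 1 (by norm_num) (by norm_num)) h1' h2'
  have ht : s₂.natVar 6 = s₁.natVar 6 := h3' 6 (by norm_num) (by norm_num)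
  have hr₂ : s₂.natVar 2 = r := by
    rw [h3' 2 (by norm_num) (by norm_num), h3 2 (by norm_num) (by norm_num), hr]
  rw [← ht] at h4 h5
  rw [← h1] at hX hp h5
  rw [← h1'] at hX hp h5 h5'
  set X := s₂.natArr 0 with hXdef
  set t := s₂.natVar 6 with htdef
  set u := s₂.natVar 7 with hudef
  have htest : s₂.realArr 1 t * weight inp u < (s₂.realArr 0 u - 1) * weight inp t ↔
      ownValue m (likes inp n m) (inp.getD 0 0) X t / weight inp t <
        (likedCount m (likes inp n m) X u - 1) / weight inp u := by
    rw [div_lt_div_iff₀ (hw t h4) (hw u h4'), hs₂.counts u h4', hs₂.values t h4]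
  refine Ensures.mono (Ensures.ite_skip (T := (m * 25 + 6) + (3 + (6 + (7 + 6)))) (by omega)
    (fun hb => ?_) (fun hb => ?_)) (by simp [BExp.cost, NExp.cost, RExp.cost]) fun _ => id
  · simp only [BExp.Holds, RExp.eval, NExp.eval, Nat.cast_one, ← htdef, ← hudef] at hb
    replace hb := htest.1 hb
    obtain ⟨U, hU⟩ := hX
    -- Values are nonnegative, so the strict inequality forces `u` to own a liked good, and
    -- `pickGood` has something to find.
    have hpos : 0 < likedCount m (likes inp n m) X u := by
      have h6 : 0 ≤ ownValue m (likes inp n m) (inp.getD 0 0) X t / weight inp t :=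
        div_nonneg (ownValue_nonneg hk t) (hw t h4).le
      have h7 := (div_pos_iff_of_pos_right (hw u h4')).1 (h6.trans_lt hb)
      linarith
    obtain ⟨g₀, hg₀, hg₀u, _⟩ := exists_of_likedCount_pos hpos
    refine Ensures.seq ((pickGood_spec hs₂.ready ⟨g₀, hg₀, hg₀u⟩).mono le_rfl ?_)
    rintro s₃ ⟨k1, k2, k3, k4, k5⟩
    set g := s₃.natVar 9 with hgdef
    replace k5 : X g = u := k5
    have hs₃ : LoadsState inp n m s₃ := hs₂.congr (k3 0 (by norm_num) (by norm_num))
      (k3 1 (by norm_num) (by norm_num)) k1 k2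
    have ht₃ : s₃.natVar 6 = t := k3 6 (by norm_num) (by norm_num)
    have hu₃ : s₃.natVar 7 = u := k3 7 (by norm_num) (by norm_num)
    have hr₃ : s₃.natVar 2 = r := (k3 2 (by norm_num) (by norm_num)).trans hr₂
    obtain ⟨hLu, hLt, V, hV⟩ := hU.move hk hw h4 h4' h5 h5' hb k4 k5
    have hut : u ≠ t := by
      intro hh
      exact hLt (hh ▸ hLu)
    have hcnt := fun j => PricedInvariant.likedCount_move (m := m) (X := X) k4 k5 hLu hLt j
    have hval := fun j => PricedInvariant.ownValue_move (m := m) (k := inp.getD 0 0) (X := X) k4 k5 hLu hLt j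
    refine Ensures.seq (Ensures.putNat (Ensures.seq (Ensures.putReal (Ensures.seq
      (Ensures.putReal (Ensures.putReal ?_))))))
    have hfin : ((((s₃.putN 0 g t).putR 0 u (s₃.realArr 0 u - 1)).putR 1 u
        (s₃.realArr 1 u - inp.getD 0 0)).putR 1 t (s₃.realArr 1 t + 1)).natArr 0 =
          Function.update X g t := by
      simp [k1, hXdef]
    simp only [NExp.eval, RExp.eval, Store.natVar_putN, Store.natVar_putR, Store.realArr_putR,
      Store.realArr_putN, ht₃, hu₃, ← hgdef, Nat.cast_one, if_true,
      one_ne_zero, if_false, Function.update_of_ne hut.symm]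
    refine ⟨hr₃, ⟨(((hs₃.ready.putN (by norm_num) _ _).putR _ _ _).putR _ _ _).putR _ _ _,
      ?_, ?_⟩, ?_, ?_⟩
    · intro a ha
      rw [hfin, hcnt a]
      have h8 : s₃.realArr 0 a = likedCount m (likes inp n m) X a := by
        rw [hs₃.counts a ha, k1]
      by_cases hau : a = u
      · rw [if_pos hau]
        subst hau
        simp [h8]
      · simp [hau, h8]
    · intro a ha
      rw [hfin, hval a]
      have h8 : s₃.realArr 1 a = ownValue m (likes inp n m) (inp.getD 0 0) X a := by
        rw [hs₃.values a ha, k1]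
      by_cases hau : a = u
      · have hat : a ≠ t := hau ▸ hut
        subst hau
        simp [h8, hut]
      · by_cases hat : a = t
        · subst hat
          simp [h8, hut.symm]
        · simp [hat, hau, h8]
    · rw [hfin]
      exact ⟨V, hV⟩
    · rw [hfin]
      rcases hp with hp | hp
      · exact absurd (hp t h4 u h4') (not_le.2 hb)
      · right
        have := unlikedTotal_move (X := X) (t := t) k4 (by rw [k5]; exact hLu) hLt
        omega
  · simp only [BExp.Holds, RExp.eval, NExp.eval, Nat.cast_one, ← htdef, ← hudef] at hb
    have hb' := mt htest.2 hb
    exact ⟨hr₂, hs₂, hX, Or.inl fun i hi j hj => (h5' j hj).trans ((not_lt.1 hb').trans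
      (h5 i hi))⟩

end Redistribution

end RealRAM

/-! ### Reading an instance from its encoding -/

namespace BivaluedInstance

variable {n m : ℕ} (I : BivaluedInstance n m)

theorem encode_weight (i : Fin n) : RealRAM.weight I.encode i = I.w i := by
  unfold RealRAM.weight encode
  rw [add_comm, List.getD_cons_succ, List.getD_append _ _ _ _ (by simp)]
  simp

theorem encode_value (i : Fin n) (e : Fin m) :
    I.encode.getD (1 + n + i * m + e) 0 = I.v i e := by
  unfold encode
  have hlt : (i : ℕ) * m + e < n * m := by
    calc (i : ℕ) * m + e < i * m + m := by omega
      _ = (i + 1) * m := by ring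
      _ ≤ n * m := Nat.mul_le_mul_right _ i.2
  have hm : 0 < m := e.pos
  rw [show 1 + n + (i : ℕ) * m + e = (n + ((i : ℕ) * m + e)) + 1 by ring, List.getD_cons_succ,
    List.getD_append_right _ _ _ _ (by simp)]
  simp only [List.length_ofFn, Nat.add_sub_cancel_left]
  rw [List.getD_eq_getElem _ _ (by simpa using hlt)]
  simp only [List.getElem_ofFn]
  congr 1
  · ext
    simp [Fin.divNat, Nat.div_eq_of_lt e.2, Nat.add_comm ((i : ℕ) * m), Nat.add_mul_div_right _ _ hm]
  · ext
    simp [Fin.modNat, Nat.add_comm ((i : ℕ) * m), Nat.mod_eq_of_lt e.2]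

theorem likes_iff (i : Fin n) (e : Fin m) :
    RealRAM.likes I.encode n m i e ↔ I.v i e = I.k := by
  unfold RealRAM.likes
  rw [encode_value]
  have := I.one_lt_k
  rcases I.v_mem i e with h | h <;> rw [h]
  · exact iff_of_false (lt_irrefl _) this.ne
  · exact iff_of_true this rfl

end BivaluedInstance

/-! ### The complete program and its running time -/

namespace RealRAM

variable {inp : List ℝ} {n m : ℕ}

/-- Computation of the row offsets; all goods are put to the position `n + 1`. -/
def prepare : Prog :=
  .seq (.setNat 6 (.add (.const 1) (.var 0)))
    (.seq (.forTo 5 0 (.seq (.putNat 3 (.var 5) (.var 6)) (.setNat 6 (.add (.var 6) (.var 1)))))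
      (.forTo 4 1 (.putNat 0 (.var 4) (.add (.var 0) (.const 1)))))

/-- Naturals cannot be multiplied, so the offsets `1 + n + a * m` are accumulated by repeated
addition. With all goods at `n + 1` every liked count is zero and balance is trivial. -/
theorem prepare_spec (hw : ∀ i < n, 0 < weight inp i) :
    Ensures inp prepare (start n m) (n * 15 + m * 13 + 16) (InsertionState inp n m 0) := by
  refine Ensures.mono (Ensures.seq (Ensures.setNat (Ensures.seq ((Ensures.forTo
    (Inv := fun a s => s.natVar 0 = n ∧ s.natVar 1 = m ∧ s.natVar 6 = 1 + n + a * m ∧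
      (∀ x < a, s.natArr 3 x = 1 + n + x * m) ∧ (∀ x, s.natArr 1 x = 0) ∧
      ∀ x, s.realArr 0 x = 0) (N := n) (T := 7) ?_ ?_ ?_).mono le_rfl ?_))))
    (T := 4 + ((n * (7 + 8) + 6) + (m * (5 + 8) + 6))) (by ring_nf; omega) fun _ => id
  · exact fun _ _ h => h.1
  · simp [start, NExp.eval]
  · rintro a ha s ⟨h0, h1, h2, h3, h4, h5⟩ hx
    refine Ensures.seq (T := 3) (T' := 4) (Ensures.putNat (Ensures.setNat ?_))
    simp only [NExp.eval, hx, h2]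
    refine ⟨by simpa using hx, by simpa using h0, by simpa using h1, ?_, fun x hxa => ?_,
      by simpa using h4, by simpa using h5⟩
    · simp [h1, h2]; ring
    · simp only [Store.natArr_setN, Store.natArr_putN, if_true, Function.update_apply]
      split_ifs with hxa'
      · rw [hxa']
      · exact h3 x (by omega)
  · rintro s ⟨h0, h1, -, h3, h4, h5⟩
    refine (Ensures.forTo (N := m) (T := 5) (fun g s => Ready n m s ∧
      (∀ x < g, s.natArr 0 x = n + 1) ∧ (∀ x, s.natArr 1 x = 0) ∧
      ∀ x, s.realArr 0 x = 0) (fun _ _ h => h.1.goods) ?_ ?_).mono le_rfl ?_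
    · exact ⟨(Ready.setN ⟨h0, h1, h3⟩ (by norm_num) _), by simp, h4, h5⟩
    · rintro g hg s ⟨h0, h1, h2, h3⟩ hx
      refine Ensures.putNat ⟨by simpa using hx, (h0.putN (by norm_num) _ _).setN (by norm_num) _,
        fun x hxg => ?_, by simpa using h2, by simpa using h3⟩
      simp only [NExp.eval, hx, h0.size, Store.natArr_setN, Store.natArr_putN, if_true,
        Function.update_apply]
      split_ifs with hxg'
      · rfl
      · exact h1 x (by omega)
    · rintro s ⟨h0, h1, h2, h3⟩
      have hzero : ∀ a < n, likedCount m (likes inp n m) (s.natArr 0) a = 0 := by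
        intro a ha
        by_contra hne
        obtain ⟨e, he, hea, _⟩ := exists_of_likedCount_pos
          (lt_of_le_of_ne (likedCount_nonneg a) (Ne.symm hne))
        have := h1 e he
        omega
      refine ⟨h0, ⟨fun i hi j hj _ => ?_, by simp, fun g _ hg => h1 g hg⟩, fun x _ => h2 x,
        fun a ha => by rw [h3, hzero a ha]⟩
      rw [hzero i hi, hzero j hj, zero_div]
      exact div_nonpos_of_nonpos_of_nonneg (by norm_num) (hw j hj).le

/-- Computation of the values of all agents, who have only goods that they like. -/
def initValues : Prog :=
  .forTo 5 0 (.putReal 1 (.var 5) (.mulInput (.get 0 (.var 5)) (.const 0)))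

theorem initValues_spec {s : Store} (hs : InsertionState inp n m m s) :
    Ensures inp initValues s (n * 14 + 6) fun s' => LoadsState inp n m s' ∧
      FairPartial n m (likes inp n m) (inp.getD 0 0) (weight inp) 0 (s'.natArr 0) := by
  refine (Ensures.forTo (N := n) (T := 6) (fun a s' => Ready n m s' ∧ s'.natArr = s.natArr ∧
    s'.realArr 0 = s.realArr 0 ∧ ∀ x < a, s'.realArr 1 x = s.realArr 0 x * inp.getD 0 0)
    (fun _ _ h => h.1.size) ?_ ?_).mono (by omega) ?_
  · exact ⟨hs.ready.setN (by norm_num) _, rfl, rfl, by simp⟩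
  · rintro a ha s' ⟨h0, h1, h2, h3⟩ hx
    refine Ensures.putReal ⟨by simpa using hx, (h0.putR _ _ _).setN (by norm_num) _, h1,
      by simpa using h2, fun x hxa => ?_⟩
    simp only [NExp.eval, RExp.eval, hx, h2, Store.realArr_setN, Store.realArr_putR, if_true,
      Function.update_apply]
    split_ifs with hxa'
    · rw [hxa']
    · exact h3 x (by omega)
  · rintro s' ⟨h0, h1, h2, h3⟩
    refine ⟨⟨h0, ?_, fun a ha => ?_⟩, ?_⟩
    · rw [h1, h2]; exact hs.counts
    · rw [h1, h3 a ha, hs.counts a ha, ownValue, unlikedCount_eq_zero, add_zero, mul_comm]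
      intro e he hea
      rcases hs.partial_alloc.done e he he with h | h
      · exact hea ▸ h.2
      · omega
    · rw [h1]; exact hs.partial_alloc.fairPartial

/-- The algorithm for weighted envy-freeness up to any good and fractional Pareto optimality. -/
def wefxProg : Prog :=
  .seq prepare (.seq (.forTo 2 1 insertGood) (.seq initValues
    (.seq (.forTo 2 1 giveGood) (.forTo 2 1 redistribute))))

theorem InsertionState.setCounter {e : ℕ} {s : Store} (h : InsertionState inp n m e s) (v : ℕ) :
    InsertionState inp n m e (s.setN 2 v) :=
  ⟨h.ready.setN le_rfl v, h.partial_alloc, h.beyond, h.counts⟩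

theorem LoadsState.setCounter {s : Store} (h : LoadsState inp n m s) (v : ℕ) :
    LoadsState inp n m (s.setN 2 v) :=
  ⟨h.ready.setN le_rfl v, h.counts, h.values⟩

theorem wefxProg_spec (hk : 1 < inp.getD 0 0) (hw : ∀ i < n, 0 < weight inp i) (hn : 0 < n)
    (hm : 0 < m) :
    Ensures inp wefxProg (start n m) (1000 * (n ^ 2 * m ^ 2)) fun s =>
      (∃ U, PricedInvariant n m (likes inp n m) (inp.getD 0 0) (weight inp) U (s.natArr 0)) ∧
      Settled inp n m (s.natArr 0) := by
  refine Ensures.mono (Ensures.seq ((prepare_spec hw).mono le_rfl fun s₁ h₁ =>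
    Ensures.seq (Ensures.mono (Ensures.forTo (InsertionState inp n m)
      (fun _ _ h => h.ready.goods) (h₁.setCounter 0) fun e he s hs hse =>
        (insertGood_spec hw he hs hse).mono le_rfl fun s' h => ⟨h.1, h.2.setCounter _⟩)
      le_rfl fun s₂ h₂ => Ensures.seq ((initValues_spec h₂).mono le_rfl fun s₃ h₃ =>
    Ensures.seq (Ensures.mono (Ensures.forTo (fun e s => LoadsState inp n m s ∧
        FairPartial n m (likes inp n m) (inp.getD 0 0) (weight inp) e (s.natArr 0))
      (fun _ _ h => h.1.ready.goods) ⟨h₃.1.setCounter 0, h₃.2⟩ fun e he s hs hse =>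
        (giveGood_spec hw hn he hs.1 hs.2 hse).mono le_rfl fun s' h =>
          ⟨h.1, h.2.1.setCounter _, h.2.2⟩)
      le_rfl fun s₄ h₄ =>
    Ensures.mono (Ensures.forTo (fun r s => LoadsState inp n m s ∧
        (∃ U, PricedInvariant n m (likes inp n m) (inp.getD 0 0) (weight inp) U (s.natArr 0)) ∧
        (Settled inp n m (s.natArr 0) ∨ r ≤ unlikedTotal m (likes inp n m) (s.natArr 0)))
      (fun _ _ h => h.1.ready.goods)
      ⟨h₄.1.setCounter 0, ⟨_, h₄.2.pricedInvariant⟩, Or.inr (Nat.zero_le _)⟩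
      fun r _ s hs hsr => (redistribute_spec hk hw hn hs.1 hs.2.1 hs.2.2 hsr).mono le_rfl
        fun s' h => ⟨h.1, h.2.1.setCounter _, h.2.2⟩)
      le_rfl fun s₅ h₅ => ⟨h₅.2.1, h₅.2.2.elim id (settled_of_unlikedTotal hk hw)⟩))))) ?_
      fun _ => id
  -- Each monomial of the total cost is dominated by `n ^ 2 * m ^ 2`; the constant `1000` leaves
  -- room for the sum of the coefficients.
  have e1 : 1 ≤ n ^ 2 * m ^ 2 := Nat.one_le_iff_ne_zero.2 (by positivity)
  have hnn : n ≤ n ^ 2 := Nat.le_self_pow two_ne_zero n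
  have hmm : m ≤ m ^ 2 := Nat.le_self_pow two_ne_zero m
  have hn1 : 1 ≤ n ^ 2 := hn.trans_le hnn
  have hm1 : 1 ≤ m ^ 2 := hm.trans_le hmm
  have e2 : n ≤ n ^ 2 * m ^ 2 := by simpa using Nat.mul_le_mul hnn hm1
  have e3 : m ≤ n ^ 2 * m ^ 2 := by simpa using Nat.mul_le_mul hn1 hmm
  have e4 : n * m ≤ n ^ 2 * m ^ 2 := Nat.mul_le_mul hnn hmm
  have e5 : n * m ^ 2 ≤ n ^ 2 * m ^ 2 := Nat.mul_le_mul hnn le_rfl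
  have e6 : m ^ 2 ≤ n ^ 2 * m ^ 2 := by simpa using Nat.mul_le_mul hn1 (le_refl (m ^ 2))
  ring_nf at e1 e2 e3 e4 e5 e6 ⊢
  omega

end RealRAM

theorem theorem2 :
    ∃ (P : RealRAM.Prog) (C : ℝ), ∀ (n m : ℕ), 0 < n → 0 < m → ∀ I : BivaluedInstance n m,
      ∃ (t : ℕ) (s : RealRAM.Store) (X : Fin m → Fin n),
        RealRAM.Run I.encode P (RealRAM.start n m) t s ∧
        (t : ℝ) ≤ C * (min I.k (m : ℝ) * (n : ℝ) ^ 2 * (m : ℝ) ^ 2) ∧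
        RealRAM.Outputs s X ∧ I.WEFX X ∧ I.FPO X := by
  refine ⟨RealRAM.wefxProg, 1000, fun n m hn hm I => ?_⟩
  have hw : ∀ i < n, 0 < RealRAM.weight I.encode i := fun i hi => by
    rw [I.encode_weight ⟨i, hi⟩]
    exact I.w_pos _
  obtain ⟨t, s, hrun, ht, ⟨U, hU⟩, hfin⟩ :=
    RealRAM.wefxProg_spec (inp := I.encode) I.one_lt_k hw hn hm
  have hv : ∀ (i : Fin n) (e : Fin m), RealRAM.likes I.encode n m i e → I.v i e = I.k :=
    fun i e h => (I.likes_iff i e).1 h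
  have hv' : ∀ (i : Fin n) (e : Fin m), ¬ RealRAM.likes I.encode n m i e → I.v i e = 1 :=
    fun i e h => (I.v_mem i e).resolve_right fun hh => h ((I.likes_iff i e).2 hh)
  refine ⟨t, s, fun e => ⟨s.natArr 0 e, hU.owner_lt e e.2⟩, hrun, ?_, fun e => rfl,
    I.wefx_of_pricedInvariant _ (fun e => rfl) hv hv' (fun i => (I.encode_weight i).symm) hU hfin,
    I.fpo_of_pricedInvariant _ (fun e => rfl) hv hv' hU⟩
  -- The proved bound lacks the factor `min I.k m`, which may be inserted because it is at least
  -- `1`.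
  have h1 : 1 ≤ min I.k (m : ℝ) := le_min I.one_lt_k.le (by exact_mod_cast hm)
  have h2 : (t : ℝ) ≤ 1000 * ((n : ℝ) ^ 2 * (m : ℝ) ^ 2) := by exact_mod_cast ht
  have h3 : (0 : ℝ) ≤ (n : ℝ) ^ 2 * (m : ℝ) ^ 2 := by positivity
  nlinarith
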